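/- Let $\mathbb{T}^d=\mathbb{R}^d/\mathbb{Z}^d$ be the standard flat torus, and let $\Sigma\subset\mathbb{T}^d$ be a (non-singular, embedded) real-analytic hypersurface: each point of $\Sigma$ has an open neighbourhood in which $\Sigma$ is the zero set of a real-analytic function with nowhere vanishing gradient. Suppose that $\Sigma$ is not flat, i.e. its shape operator is not identically zero (equivalently, at some point of $\Sigma$ not all principal curvatures vanish). Then there is a cap $\Omega_\Sigma=\{v\in S^{d-1}: |v-w|<r\}$, with $w\in S^{d-1}$ and $r>0$ depending only on $\Sigma$, such that for every $N$ there is a constant $C=C(\Sigma,N)>0$ with the following property. For every $\lambda>0$ and every eigenfunction $\varphi$ of the Laplacian on $\mathbb{T}^d$ with $-\Delta\varphi=4\pi^2\lambda^2\varphi$ which vanishes on $\Sigma$, the Fourier coefficients $a_\xi=\int_{\mathbb{T}^d}\varphi(x)e^{-2\pi i\langle\xi,x\rangle}\,dx$ satisfy $$|a_\xi|\le C\,\frac{\|\varphi\|_2}{\lambda^{N}}$$ for all $\xi\in\mathbb{Z}^d$ with $|\xi|=\lambda$ and $\xi/|\xi|\in\Omega_\Sigma$. -/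

import Mathlib

open scoped Laplacian

noncomputable section

/-- The projection `ℝ^d → 𝕋^d = ℝ^d / ℤ^d` of Euclidean space onto the flat torus. -/
def torusProj (d : ℕ) (x : EuclideanSpace ℝ (Fin d)) : UnitAddTorus (Fin d) :=
  fun i => (x i : UnitAddCircle)

/-- The integer vector `ξ` as a point of Euclidean space. -/
def latticeVec {d : ℕ} (ξ : Fin d → ℤ) : EuclideanSpace ℝ (Fin d) :=
  WithLp.toLp 2 fun i => (ξ i : ℝ)

/-- `g` is a real-analytic defining function, on the open neighbourhood `U` of `p`, of the subset
`M` of `ℝ^d`: inside `U` the set `M` is the zero set of `g`, and the gradient of `g` does not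
vanish. -/
structure IsLocalDefiningFunction {d : ℕ} (M U : Set (EuclideanSpace ℝ (Fin d)))
    (g : EuclideanSpace ℝ (Fin d) → ℝ) (p : EuclideanSpace ℝ (Fin d)) : Prop where
  isOpen : IsOpen U
  mem : p ∈ U
  analytic : AnalyticOnNhd ℝ g U
  mem_iff : ∀ x ∈ U, x ∈ M ↔ g x = 0
  gradient_ne_zero : ∀ x ∈ U, gradient g x ≠ 0

/-- A (non-singular, embedded) real-analytic hypersurface of the torus. The projection of `ℝ^d`
onto the torus is locally an analytic isometry, so the condition is stated on the preimage of `S`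
in `ℝ^d`. -/
def IsAnalyticHypersurface {d : ℕ} (S : Set (UnitAddTorus (Fin d))) : Prop :=
  ∀ p ∈ torusProj d ⁻¹' S, ∃ U g, IsLocalDefiningFunction (torusProj d ⁻¹' S) U g p

/-- The unit normal field `∇g / |∇g|` to the level sets of `g`. -/
def unitNormal {d : ℕ} (g : EuclideanSpace ℝ (Fin d) → ℝ) (x : EuclideanSpace ℝ (Fin d)) :
    EuclideanSpace ℝ (Fin d) :=
  ‖gradient g x‖⁻¹ • gradient g x

/-- The shape operator `v ↦ -∇_v N` at `p` (for tangent vectors `v`), where `N` is the unit normal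
field determined by the defining function `g`. -/
def shapeOperator {d : ℕ} (g : EuclideanSpace ℝ (Fin d) → ℝ) (p v : EuclideanSpace ℝ (Fin d)) :
    EuclideanSpace ℝ (Fin d) :=
  -fderiv ℝ (unitNormal g) p v

/-- A hypersurface of the torus is flat if its shape operator is identically zero, that is, if all
its principal curvatures vanish at all its points. Tangent vectors at `p` are the vectors orthogonal
to the gradient of a defining function. Up to sign, the shape operator on them does not depend on
the defining function. -/
def IsFlatHypersurface {d : ℕ} (S : Set (UnitAddTorus (Fin d))) : Prop :=
  ∀ p ∈ torusProj d ⁻¹' S, ∀ U g, IsLocalDefiningFunction (torusProj d ⁻¹' S) U g p →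
    ∀ v : EuclideanSpace ℝ (Fin d), inner ℝ (gradient g p) v = 0 → shapeOperator g p v = 0

/-- `φ` is an eigenfunction of the Laplacian on the flat torus with eigenvalue `4π²λ²`:
`φ` is not zero, its lift to `ℝ^d` is twice continuously differentiable, and
`-Δφ = 4π²λ² φ`. -/
structure IsTorusEigenfunction {d : ℕ} (lam : ℝ) (φ : UnitAddTorus (Fin d) → ℂ) : Prop where
  ne_zero : φ ≠ 0
  contDiff : ContDiff ℝ 2 (φ ∘ torusProj d)
  eigen : ∀ x, -(Δ (φ ∘ torusProj d)) x =
    ((4 * Real.pi ^ 2 * lam ^ 2 : ℝ) : ℂ) * (φ ∘ torusProj d) x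

/-- The norm of `φ` in `L²(𝕋^d)`, with respect to the Haar probability measure. It is used for
continuous functions only. -/
def torusL2Norm {d : ℕ} (φ : UnitAddTorus (Fin d) → ℂ) : ℝ :=
  Real.sqrt (∫ x, ‖φ x‖ ^ 2
    ∂(MeasureTheory.Measure.pi fun _ : Fin d => (AddCircle.haarAddCircle (T := (1 : ℝ)))))

/-- The open cap of radius `r` around `w` on the unit sphere `S^{d-1}`. -/
def sphericalCap {d : ℕ} (w : EuclideanSpace ℝ (Fin d)) (r : ℝ) :
    Set (EuclideanSpace ℝ (Fin d)) :=
  {v | ‖v‖ = 1 ∧ dist v w < r}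

end

/-! The eigenfunction is a trigonometric polynomial `Σ a_ξ e(⟨ξ, x⟩)` over integer points with `|ξ|
= λ`, where `e(w) = exp(2πi w)`, so it extends to an entire function on `ℂ^d` that vanishes on the
complexification of the hypersurface. The proof evaluates this extension at well chosen complex
points and isolates a group of frequencies around a given `ξ₀`.

Geometry. Near a point where the shape operator is nonzero, the hypersurface is an analytic graph
over its tangent plane whose height is not identically zero on that plane. The height vanishes to
second order at the point, and a one-variable open mapping argument (`exists_im_ne_im_mul_deriv`)
gives a complex point `z` of the hypersurface at which `Im z` is transversal to the complexified
tangent space. The implicit function theorem then gives, for `ω` close to `w = -Im z / |Im z|` and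
`y` in a complex ball around `Re z`, a point `y + W(y) ω` of the complexification, with `W`
holomorphic and `Im W ≤ 0` (`exists_complex_points_along_lines`).

Arithmetic. Comparing the spans of the differences `ξ - ξ₀` at `d + 2` rapidly growing scales, two
consecutive spans agree. Hence `ξ₀` lies in a cluster of size `D`, with a unit vector `ω` close to
`ξ₀ / λ`, such that `⟨ξ - ξ₀, ω⟩` is zero on the cluster and nonpositive elsewhere, all other
frequencies being at distance at least `D ^ K` (`exists_isolated_cluster`). The key input is that an
integer Gram determinant that is nonzero is at least 1 in absolute value.

Analysis. Dividing the vanishing sum by the exponential of `ξ₀`, the cluster contributes `e(⟨ξ - ξ₀,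
y⟩)`, free of `W`, whereas in the other terms the factor involving `W` has modulus at most 1.
Averaging in `y` against a polynomial bump and shifting one coordinate into the complex domain makes
those terms exponentially small (`norm_setIntegral_cube_bump_mul_le`). Finite differences then
remove the rest of the cluster and leave `a_ξ₀` (`norm_coeff_le_of_exp_sum_le`). Their cost is of
order `exp(D ^ (d + 1))`, which the isolation exponent `K = d + 4` beats. The outcome is decay like
`exp(-λ ^ δ)` up to a polynomial factor, stronger than any power of `λ`. -/

/-! ### Complexification of real-analytic functions -/

/-- The inclusion of real Euclidean space into `ℂ^d`. -/
noncomputable def toComplex {d : ℕ} (x : EuclideanSpace ℝ (Fin d)) : Fin d → ℂ := fun i => (x i : ℂ)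

/-- The coefficient-wise complexification of a real multilinear form on Euclidean space. -/
noncomputable def complexifyForm {d n : ℕ} (P : EuclideanSpace ℝ (Fin d) [×n]→L[ℝ] ℝ) :
    (Fin d → ℂ) [×n]→L[ℂ] ℂ :=
  ∑ i : Fin n → Fin d, ((P fun k => EuclideanSpace.single (i k) 1 : ℝ) : ℂ) •
    (ContinuousMultilinearMap.mkPiAlgebra ℂ (Fin n) ℂ).compContinuousLinearMap
      fun k => ContinuousLinearMap.proj (i k)

theorem complexifyForm_apply {d n : ℕ} (P : EuclideanSpace ℝ (Fin d) [×n]→L[ℝ] ℝ)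
    (z : Fin n → Fin d → ℂ) :
    complexifyForm P z = ∑ i : Fin n → Fin d,
      ((P fun k => EuclideanSpace.single (i k) 1 : ℝ) : ℂ) * ∏ k, z k (i k) := by
  simp [complexifyForm]

theorem complexifyForm_toComplex {d n : ℕ} (P : EuclideanSpace ℝ (Fin d) [×n]→L[ℝ] ℝ)
    (x : Fin n → EuclideanSpace ℝ (Fin d)) :
    complexifyForm P (fun k => toComplex (x k)) = (P x : ℂ) := by
  rw [complexifyForm_apply]
  have hx : x = fun k => ∑ j, (x k j) • EuclideanSpace.single j (1 : ℝ) := by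
    funext k
    ext j
    simp [Finset.sum_apply, Pi.single_apply]
  conv_rhs => rw [hx]
  have h2 := P.toMultilinearMap.map_sum
    (fun k (j : Fin d) => (x k j) • EuclideanSpace.single j (1 : ℝ))
  rw [ContinuousMultilinearMap.coe_coe] at h2
  rw [h2]
  push_cast
  refine Finset.sum_congr rfl fun i _ => ?_
  have h3 := P.toMultilinearMap.map_smul_univ (fun k => x k (i k))
    (fun k => EuclideanSpace.single (i k) (1 : ℝ))
  rw [ContinuousMultilinearMap.coe_coe] at h3
  rw [h3]
  simp [toComplex, mul_comm]

/-- There are `d ^ n` index tuples, each with a coefficient bounded by `‖P‖`. The loss is geometric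
in `n`, so a power series keeps a positive radius of convergence. -/
theorem norm_complexifyForm_le {d n : ℕ} (P : EuclideanSpace ℝ (Fin d) [×n]→L[ℝ] ℝ) :
    ‖complexifyForm P‖ ≤ (d : ℝ) ^ n * ‖P‖ := by
  refine ContinuousMultilinearMap.opNorm_le_bound (by positivity) fun z => ?_
  rw [complexifyForm_apply]
  refine (norm_sum_le _ _).trans ?_
  have : ∀ i ∈ (Finset.univ : Finset (Fin n → Fin d)),
      ‖((P fun k => EuclideanSpace.single (i k) 1 : ℝ) : ℂ) * ∏ k, z k (i k)‖
        ≤ ‖P‖ * ∏ k, ‖z k‖ := by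
    intro i _
    rw [norm_mul, norm_prod, Complex.norm_real]
    gcongr with k
    · refine (P.le_opNorm _).trans ?_
      simp
    · exact norm_le_pi_norm (z k) (i k)
  refine (Finset.sum_le_card_nsmul _ _ _ this).trans ?_
  simp [mul_assoc]

theorem norm_toComplex_le {d : ℕ} (x : EuclideanSpace ℝ (Fin d)) : ‖toComplex x‖ ≤ ‖x‖ := by
  refine (pi_norm_le_iff_of_nonneg (norm_nonneg _)).2 fun i => ?_
  simpa [toComplex] using PiLp.norm_apply_le x i

/-- The complex side carries the sup norm, so real and complex balls have to be compared; the crude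
constant `d` is enough. -/
theorem norm_le_mul_norm_toComplex {d : ℕ} (x : EuclideanSpace ℝ (Fin d)) :
    ‖x‖ ≤ d * ‖toComplex x‖ := by
  have hx : x = ∑ j, (x j) • EuclideanSpace.single j (1 : ℝ) := by
    ext j
    simp [Finset.sum_apply, Pi.single_apply]
  calc ‖x‖ = ‖∑ j, (x j) • EuclideanSpace.single j (1 : ℝ)‖ := by rw [← hx]
    _ ≤ ∑ j : Fin d, ‖toComplex x‖ := by
      refine norm_sum_le_of_le _ fun j _ => ?_
      have := norm_le_pi_norm (toComplex x) j
      simpa [toComplex, norm_smul] using this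
    _ = d * ‖toComplex x‖ := by simp

/-- A real-analytic function on Euclidean space extends holomorphically to a complex
neighbourhood. -/
theorem AnalyticAt.exists_complexification {d : ℕ} {h : EuclideanSpace ℝ (Fin d) → ℝ}
    {p : EuclideanSpace ℝ (Fin d)} (hh : AnalyticAt ℝ h p) :
    ∃ (ρ : ℝ) (H : (Fin d → ℂ) → ℂ), 0 < ρ ∧
      AnalyticOnNhd ℂ H (Metric.ball (toComplex p) ρ) ∧
      ∀ x, toComplex x ∈ Metric.ball (toComplex p) ρ → H (toComplex x) = h x := by
  obtain ⟨P, r, hP⟩ := hh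
  let Q : FormalMultilinearSeries ℂ (Fin d → ℂ) ℂ := fun n => complexifyForm (P n)
  have hrad : 0 < Q.radius := by
    obtain ⟨s, hs0, hs⟩ : ∃ s : NNReal, 0 < s ∧ (s : ENNReal) < P.radius := by
      obtain ⟨s, hs0, hs⟩ := ENNReal.lt_iff_exists_nnreal_btwn.1 (hP.r_pos.trans_le hP.r_le)
      exact ⟨s, by simpa using hs0, hs⟩
    obtain ⟨C, hC0, hC⟩ := P.norm_mul_pow_le_of_lt_radius hs
    -- Shrinking the radius by `d + 1` absorbs the factor `d ^ n`, and is meaningful also for `d =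
    -- 0`.
    have h1 : ((s / (d + 1) : NNReal) : ENNReal) ≤ Q.radius := by
      refine Q.le_radius_of_bound C fun n => ?_
      refine le_trans ?_ (hC n)
      have h2 := norm_complexifyForm_le (P n)
      calc ‖Q n‖ * ((s / (d + 1) : NNReal) : ℝ) ^ n
          ≤ ((d : ℝ) ^ n * ‖P n‖) * ((s / (d + 1) : NNReal) : ℝ) ^ n := by
            gcongr
        _ = ‖P n‖ * (d * (s / (d + 1))) ^ n := by
            push_cast
            rw [mul_pow]
            ring
        _ ≤ ‖P n‖ * (s : ℝ) ^ n := by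
            gcongr
            rw [mul_div_assoc', div_le_iff₀ (by positivity)]
            nlinarith [s.coe_nonneg]
    refine lt_of_lt_of_le ?_ h1
    have : 0 < s / (d + 1) := by positivity
    exact_mod_cast this
  have hQ := Q.hasFPowerSeriesOnBall hrad
  obtain ⟨t, ht0, ht⟩ : ∃ t : NNReal, 0 < t ∧ (t : ENNReal) < min Q.radius r := by
    obtain ⟨s, hs0, hs⟩ := ENNReal.lt_iff_exists_nnreal_btwn.1 (lt_min hrad hP.r_pos)
    exact ⟨s, by simpa using hs0, hs⟩
  -- A real point in the sup-norm ball of radius `t / (d + 1)` is within Euclidean distance `t` of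
  -- `p`, where the real series converges as well.
  refine ⟨t / (d + 1), fun z => Q.sum (z - toComplex p), by positivity, ?_, ?_⟩
  · intro z hz
    have h1 : AnalyticAt ℂ Q.sum (z - toComplex p) := by
      refine hQ.analyticOnNhd _ ?_
      rw [Metric.mem_ball, dist_eq_norm] at hz
      have : ‖z - toComplex p‖ < t := hz.trans_le (div_le_self t.coe_nonneg (by simp))
      rw [Metric.mem_eball, edist_zero_right]
      refine lt_trans ?_ (ht.trans_le (min_le_left _ _))
      rw [← ofReal_norm]
      rw [← ENNReal.ofReal_coe_nnreal]
      exact (ENNReal.ofReal_lt_ofReal_iff (by exact_mod_cast ht0)).2 this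
    exact h1.comp_of_eq (by fun_prop) rfl
  · intro x hx
    have hxp : toComplex x - toComplex p = toComplex (x - p) := by
      funext i; simp [toComplex]
    rw [Metric.mem_ball, dist_eq_norm, hxp] at hx
    have hd : (0 : ℝ) < d + 1 := by positivity
    have hx2 : ‖x - p‖ < t := by
      have h3 := norm_le_mul_norm_toComplex (x - p)
      rw [lt_div_iff₀ hd] at hx
      nlinarith [norm_nonneg (toComplex (x - p))]
    have hen : ‖x - p‖ₑ < (t : ENNReal) := by
      rw [← ofReal_norm, ← ENNReal.ofReal_coe_nnreal]
      exact (ENNReal.ofReal_lt_ofReal_iff (by exact_mod_cast ht0)).2 hx2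
    have h1 := hP.hasSum (y := x - p) (by
      rw [Metric.mem_eball, edist_zero_right]
      exact hen.trans (ht.trans_le (min_le_right _ _)))
    have h1' : HasSum (fun n => ((P n (fun _ => x - p) : ℝ) : ℂ)) ((h x : ℝ) : ℂ) := by
      have := Complex.hasSum_ofReal.2 h1
      simpa using this
    have h2 : Q.sum (toComplex (x - p)) = ((h x : ℝ) : ℂ) := by
      rw [FormalMultilinearSeries.sum, ← h1'.tsum_eq]
      congr 1
      funext n
      exact complexifyForm_toComplex (P n) _
    change Q.sum (toComplex x - toComplex p) = _
    rw [hxp, h2]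

/-! ### A one-variable transversality criterion -/

section OneVariable

open Filter Topology

/-- A holomorphic function with `Im k(t) = Im t * k'(t)` on a disc and vanishing one-jet at the
centre is zero. -/
theorem exists_im_ne_im_mul_deriv {k : ℂ → ℂ} {R : ℝ}
    (hk : DifferentiableOn ℂ k (Metric.ball 0 R)) (h0 : k 0 = 0) (h1 : deriv k 0 = 0)
    (hne : ∃ t ∈ Metric.ball (0 : ℂ) R, k t ≠ 0) :
    ∃ t ∈ Metric.ball (0 : ℂ) R, ((k t).im : ℂ) ≠ t.im * deriv k t := by
  by_contra! hcon
  obtain ⟨t₀, ht₀, hkt₀⟩ := hne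
  have hR : 0 < R := Metric.pos_of_mem_ball ht₀
  have hopen : IsOpen (Metric.ball (0 : ℂ) R) := Metric.isOpen_ball
  have han : AnalyticOnNhd ℂ (deriv k) (Metric.ball 0 R) := (hk.analyticOnNhd hopen).deriv
  -- Off the real axis the assumed identity says `k' = Im k / Im t`, so `k'` is real there.
  have hreal : ∀ t ∈ Metric.ball (0 : ℂ) R, t.im ≠ 0 → (deriv k t).im = 0 := by
    intro t ht him
    have := congrArg Complex.im (hcon t ht)
    simp only [Complex.ofReal_im, Complex.mul_im, Complex.ofReal_re, zero_mul, add_zero] at this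
    exact (mul_eq_zero.1 this.symm).resolve_left him
  -- By the open mapping theorem, a non-constant `k'` would map the part of the disc off the real
  -- axis to an open subset of `ℂ`, which cannot be contained in the real line.
  have hconst : ∃ w, ∀ z ∈ Metric.ball (0 : ℂ) R, deriv k z = w := by
    refine (han.is_constant_or_isOpen (convex_ball _ _).isPreconnected).resolve_right fun hop => ?_
    let s : Set ℂ := Metric.ball 0 R ∩ {z | z.im ≠ 0}
    have hs : IsOpen s := hopen.inter (isOpen_ne_fun Complex.continuous_im continuous_const)
    have hs0 : (deriv k '' s).Nonempty := by
      refine ⟨_, ((R / 2 : ℝ) : ℂ) * Complex.I, ⟨?_, ?_⟩, rfl⟩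
      · simp [abs_of_pos hR, hR]
      · simp [hR.ne']
    obtain ⟨w, hw⟩ := hs0
    have himg := hop s Set.inter_subset_left hs
    obtain ⟨ε, hε, hball⟩ := Metric.isOpen_iff.1 himg w hw
    have hw0 : ∀ u ∈ deriv k '' s, u.im = 0 := by
      rintro _ ⟨t, ⟨ht, hti⟩, rfl⟩
      exact hreal t ht hti
    have h2 := hw0 _ (hball (show w + ((ε / 2 : ℝ) : ℂ) * Complex.I ∈ Metric.ball w ε by
      simp [abs_of_pos hε, hε]))
    have h3 := hw0 w hw
    simp [h3, hε.ne'] at h2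
  obtain ⟨w, hw⟩ := hconst
  have hw0 : w = 0 := by rw [← hw 0 (Metric.mem_ball_self hR), h1]
  have hk0 : k t₀ = k 0 := by
    refine hopen.is_const_of_deriv_eq_zero (convex_ball _ _).isPreconnected hk ?_ ht₀
      (Metric.mem_ball_self hR)
    intro z hz
    simp [hw z hz, hw0]
  exact hkt₀ (hk0.trans h0)

end OneVariable

/-! ### Analytic hypersurfaces as graphs, and flatness -/

section Graph

open Filter Topology

variable {d : ℕ}

theorem fderiv_eq_inner_gradient {g : EuclideanSpace ℝ (Fin d) → ℝ}
    {x : EuclideanSpace ℝ (Fin d)} (v : EuclideanSpace ℝ (Fin d)) :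
    fderiv ℝ g x v = inner ℝ (gradient g x) v := by
  rw [gradient, InnerProductSpace.toDual_symm_apply]

/-- An analytic hypersurface is locally an analytic graph over its tangent plane: the height
function `h` flattens the defining function. -/
theorem IsLocalDefiningFunction.exists_graph {M U : Set (EuclideanSpace ℝ (Fin d))}
    {g : EuclideanSpace ℝ (Fin d) → ℝ} {p n : EuclideanSpace ℝ (Fin d)}
    (hg : IsLocalDefiningFunction M U g p) (hp : p ∈ M)
    (hn : inner ℝ (gradient g p) n = 1) :
    ∃ h : EuclideanSpace ℝ (Fin d) → ℝ, AnalyticAt ℝ h p ∧ h p = 0 ∧ fderiv ℝ h p = 0 ∧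
      ∀ᶠ x in 𝓝 p, x + h x • n ∈ U ∧ g (x + h x • n) = inner ℝ (gradient g p) (x - p) := by
  set ν := gradient g p with hν
  have hga : AnalyticAt ℝ g p := hg.analytic p hg.mem
  have hgp : g p = 0 := (hg.mem_iff p hg.mem).1 hp
  -- Subtracting the linear form lets `h` be defined on a full neighbourhood of `p`. On the tangent
  -- plane the form is zero, so there `x + h x • n` lies on the hypersurface.
  let f : EuclideanSpace ℝ (Fin d) × ℝ → ℝ := fun u => g (u.1 + u.2 • n) - inner ℝ ν (u.1 - p)
  have hfa : AnalyticAt ℝ f (p, 0) := by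
    have h1 : AnalyticAt ℝ (fun u : EuclideanSpace ℝ (Fin d) × ℝ => g (u.1 + u.2 • n)) (p, 0) := by
      refine AnalyticAt.comp_of_eq (y := p) hga ?_ (by simp)
      exact analyticAt_fst.add (analyticAt_snd.smul analyticAt_const)
    have h2 : AnalyticAt ℝ (fun u : EuclideanSpace ℝ (Fin d) × ℝ => inner ℝ ν (u.1 - p)) (p, 0) := by
      exact ((innerSL ℝ ν).analyticAt _).comp (analyticAt_fst.sub analyticAt_const)
    exact h1.sub h2
  -- Here `⊤ : WithTop ℕ∞` is the analytic class, so the implicit function is analytic and not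
  -- merely smooth.
  have cdf : ContDiffAt ℝ ⊤ f (p, 0) := hfa.contDiffAt
  have hf0 : f (p, 0) = 0 := by simp [f, hgp]
  have hder : fderiv ℝ f (p, 0) ∘L .inr ℝ (EuclideanSpace ℝ (Fin d)) ℝ =
      ContinuousLinearMap.id ℝ ℝ := by
    ext
    have hc : HasFDerivAt f (fderiv ℝ f (p, 0)) (p, 0) := hfa.differentiableAt.hasFDerivAt
    have hline : HasDerivAt (fun s : ℝ => ((p, s) : EuclideanSpace ℝ (Fin d) × ℝ)) (0, 1) 0 :=
      (hasDerivAt_const _ _).prodMk (hasDerivAt_id _)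
    have h1 : HasDerivAt (fun s : ℝ => f (p, s)) (fderiv ℝ f (p, 0) (0, 1)) 0 :=
      hc.comp_hasDerivAt (0 : ℝ) hline
    have hline2 : HasDerivAt (fun s : ℝ => p + s • n) n 0 := by
      simpa using ((hasDerivAt_id (0 : ℝ)).smul_const n).const_add p
    have h2 : HasDerivAt (fun s : ℝ => f (p, s)) 1 0 := by
      have h3 : HasDerivAt (fun s : ℝ => g (p + s • n)) (fderiv ℝ g p n) 0 := by
        refine HasFDerivAt.comp_hasDerivAt (0 : ℝ) ?_ hline2
        simpa using hga.differentiableAt.hasFDerivAt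
      rw [fderiv_eq_inner_gradient, hn] at h3
      simpa [f] using h3
    simpa using h1.unique h2
  have if₂ : (fderiv ℝ f (p, 0) ∘L .inr ℝ (EuclideanSpace ℝ (Fin d)) ℝ).IsInvertible := by
    rw [hder]
    exact ⟨ContinuousLinearEquiv.refl ℝ ℝ, rfl⟩
  have pn : (⊤ : WithTop ℕ∞) ≠ 0 := by simp
  let h := cdf.implicitFunction pn if₂
  have hp0 : h p = 0 := cdf.implicitFunction_apply_self pn if₂
  have hcd : ContDiffAt ℝ ⊤ h p := cdf.contDiffAt_implicitFunction pn if₂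
  have hha : AnalyticAt ℝ h p := hcd.analyticAt
  have hev : ∀ᶠ x in 𝓝 p, f (x, h x) = f (p, 0) := cdf.eventually_apply_implicitFunction pn if₂
  have hev2 : ∀ᶠ x in 𝓝 p, g (x + h x • n) = inner ℝ ν (x - p) := by
    filter_upwards [hev] with x hx
    rw [hf0] at hx
    exact sub_eq_zero.1 hx
  refine ⟨h, hha, hp0, ?_, ?_⟩
  -- Differentiating `g (x + h x • n) = ⟪ν, x - p⟫` at `p` gives `⟪ν, v⟫ + dh(v) ⟪ν, n⟫ = ⟪ν, v⟫`.
  · ext v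
    have h1 : HasFDerivAt (fun x => x + h x • n)
        (ContinuousLinearMap.id ℝ _ + (fderiv ℝ h p).smulRight n) p :=
      (hasFDerivAt_id p).add (hha.differentiableAt.hasFDerivAt.smul_const n)
    have h2 : HasFDerivAt (fun x => g (x + h x • n))
        ((fderiv ℝ g p).comp (ContinuousLinearMap.id ℝ _ + (fderiv ℝ h p).smulRight n)) p := by
      refine HasFDerivAt.comp p ?_ h1
      simpa [hp0] using hga.differentiableAt.hasFDerivAt
    have h3 : HasFDerivAt (fun x => inner ℝ ν (x - p)) (innerSL ℝ ν) p := by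
      have h5 : HasFDerivAt (fun x : EuclideanSpace ℝ (Fin d) => x - p)
          (ContinuousLinearMap.id ℝ _) p := (hasFDerivAt_id p).sub_const p
      exact HasFDerivAt.comp (g := innerSL ℝ ν) (f := fun x => x - p) p
        (ContinuousLinearMap.hasFDerivAt _) h5
    have h4 := congrArg (fun L => L v) (h2.unique (h3.congr_of_eventuallyEq hev2))
    simp only [ContinuousLinearMap.comp_apply, add_apply,
      ContinuousLinearMap.id_apply, ContinuousLinearMap.smulRight_apply,
      fderiv_eq_inner_gradient, inner_add_right, inner_smul_right,
      innerSL_apply_apply, ← hν, hn] at h4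
    simpa using h4
  · have hcont : ContinuousAt (fun x => x + h x • n) p := by
      have := hha.continuousAt
      fun_prop
    have : ∀ᶠ x in 𝓝 p, x + h x • n ∈ U :=
      hcont.eventually (hg.isOpen.mem_nhds (by simpa [hp0] using hg.mem))
    exact this.and hev2

/-- If a hypersurface contains a neighbourhood of `p` in its tangent plane at `p`, the shape
operator at `p` vanishes. -/
theorem shapeOperator_eq_zero_of_eventually_zero {U : Set (EuclideanSpace ℝ (Fin d))}
    {g : EuclideanSpace ℝ (Fin d) → ℝ} {p v : EuclideanSpace ℝ (Fin d)}
    (hU : IsOpen U) (hpU : p ∈ U) (hg : AnalyticOnNhd ℝ g U) (hν : gradient g p ≠ 0)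
    (hz : ∀ᶠ x in 𝓝 p, inner ℝ (gradient g p) (x - p) = 0 → g x = 0)
    (hv : inner ℝ (gradient g p) v = 0) : shapeOperator g p v = 0 := by
  set ν := gradient g p with hνdef
  -- Without differentiability `fderiv` takes its default value 0 and the claim is trivial, so the
  -- regularity of the normal field need not be proved.
  by_cases hdiff : DifferentiableAt ℝ (unitNormal g) p
  swap
  · simp [shapeOperator, fderiv_zero_of_not_differentiableAt hdiff]
  have hline : HasDerivAt (fun t : ℝ => p + t • v) v 0 := by
    simpa using ((hasDerivAt_id (0 : ℝ)).smul_const v).const_add p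
  have htend : Tendsto (fun t : ℝ => p + t • v) (𝓝 0) (𝓝 p) := by
    simpa using hline.continuousAt.tendsto
  -- Since `g` vanishes on the tangent plane near `p`, its gradient at the points of this plane has
  -- no tangential component.
  have hgrad : ∀ᶠ x in 𝓝 p, inner ℝ ν (x - p) = 0 →
      ∀ b, inner ℝ ν b = 0 → inner ℝ (gradient g x) b = 0 := by
    filter_upwards [hz.eventually_nhds, hU.mem_nhds hpU] with x hx hxU hx0 b hb
    have hgx : DifferentiableAt ℝ g x := (hg x hxU).differentiableAt
    rw [← fderiv_eq_inner_gradient]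
    have hl : HasDerivAt (fun t : ℝ => x + t • b) b 0 := by
      simpa using ((hasDerivAt_id (0 : ℝ)).smul_const b).const_add x
    have h1 : HasDerivAt (fun t : ℝ => g (x + t • b)) (fderiv ℝ g x b) 0 := by
      refine HasFDerivAt.comp_hasDerivAt (0 : ℝ) ?_ hl
      simpa using hgx.hasFDerivAt
    have ht : Tendsto (fun t : ℝ => x + t • b) (𝓝 0) (𝓝 x) := by
      simpa using hl.continuousAt.tendsto
    have h2 : (fun t : ℝ => g (x + t • b)) =ᶠ[𝓝 0] fun _ => (0 : ℝ) := by
      filter_upwards [ht.eventually hx] with t ht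
      refine ht ?_
      rw [add_sub_right_comm, inner_add_right, inner_smul_right, hx0, hb]
      simp
    exact h1.unique ((hasDerivAt_const (0 : ℝ) (0 : ℝ)).congr_of_eventuallyEq h2)
  have hcontg : ContinuousAt (gradient g) p := by
    have : ContinuousAt (fderiv ℝ g) p := (hg p hpU).fderiv.continuousAt
    exact (LinearIsometryEquiv.continuous _).continuousAt.comp this
  -- Continuity fixes the sign: on the plane the gradient is a positive multiple of `ν`, so the unit
  -- normal is constant there.
  have hpos : ∀ᶠ x in 𝓝 p, 0 < inner ℝ (gradient g x) ν := by
    have hc : ContinuousAt (fun x => inner ℝ (gradient g x) ν) p :=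
      hcontg.inner continuousAt_const
    refine hc.eventually (lt_mem_nhds ?_)
    change 0 < inner ℝ ν ν
    rw [real_inner_self_eq_norm_sq]
    positivity
  have hN : (fun t : ℝ => unitNormal g (p + t • v)) =ᶠ[𝓝 0] fun _ => ‖ν‖⁻¹ • ν := by
    filter_upwards [htend.eventually hgrad, htend.eventually hpos] with t h1 h2
    have h3 : inner ℝ ν (p + t • v - p) = 0 := by
      rw [add_sub_cancel_left, inner_smul_right, hv, mul_zero]
    have h4 := h1 h3
    set G := gradient g (p + t • v)
    have hνn : (0 : ℝ) < ‖ν‖ := norm_pos_iff.2 hν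
    set c : ℝ := inner ℝ G ν / ‖ν‖ ^ 2 with hc
    have hcpos : 0 < c := by positivity
    have hort : inner ℝ ν (G - c • ν) = 0 := by
      rw [inner_sub_right, inner_smul_right, real_inner_self_eq_norm_sq, hc, real_inner_comm]
      field_simp
      ring
    have h5 := h4 _ hort
    have h6 : inner ℝ (G - c • ν) (G - c • ν) = 0 := by
      rw [inner_sub_left, h5, inner_smul_left, hort]
      simp
    have h7 : G = c • ν := sub_eq_zero.1 (inner_self_eq_zero.1 h6)
    change ‖G‖⁻¹ • G = _
    rw [h7, norm_smul, Real.norm_of_nonneg hcpos.le, smul_smul]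
    congr 1
    field_simp
  have h1 : HasDerivAt (fun t : ℝ => unitNormal g (p + t • v)) (fderiv ℝ (unitNormal g) p v) 0 := by
    refine HasFDerivAt.comp_hasDerivAt (l := unitNormal g) (0 : ℝ) ?_ hline
    simpa using hdiff.hasFDerivAt
  have h2 := h1.unique ((hasDerivAt_const (0 : ℝ) (‖ν‖⁻¹ • ν)).congr_of_eventuallyEq hN)
  simp [shapeOperator, h2]

end Graph

/-! ### Complex points of a non-flat hypersurface -/

section ComplexPoints

open Filter Topology

variable {d : ℕ}

/-- The complex-linear extension of the linear form `⟪ν, ·⟫`. -/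
noncomputable def complexInner (ν : EuclideanSpace ℝ (Fin d)) : (Fin d → ℂ) →L[ℂ] ℂ :=
  ∑ i, (ν i : ℂ) • ContinuousLinearMap.proj i

theorem complexInner_apply (ν : EuclideanSpace ℝ (Fin d)) (z : Fin d → ℂ) :
    complexInner ν z = ∑ i, (ν i : ℂ) * z i := by
  simp [complexInner]

theorem complexInner_toComplex (ν x : EuclideanSpace ℝ (Fin d)) :
    complexInner ν (toComplex x) = ((inner ℝ ν x : ℝ) : ℂ) := by
  simp [complexInner_apply, toComplex, PiLp.inner_apply, mul_comm]

/-- The coordinatewise real part. -/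
noncomputable def reVec (z : Fin d → ℂ) : EuclideanSpace ℝ (Fin d) :=
  WithLp.toLp 2 fun i => (z i).re

/-- The coordinatewise imaginary part. -/
noncomputable def imVec (z : Fin d → ℂ) : EuclideanSpace ℝ (Fin d) :=
  WithLp.toLp 2 fun i => (z i).im

theorem toComplex_reVec_add_imVec (z : Fin d → ℂ) :
    toComplex (reVec z) + Complex.I • toComplex (imVec z) = z := by
  funext i
  simp only [toComplex, reVec, imVec, Pi.add_apply, Pi.smul_apply, smul_eq_mul]
  rw [mul_comm]
  exact Complex.re_add_im _

theorem toComplex_add (x y : EuclideanSpace ℝ (Fin d)) :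
    toComplex (x + y) = toComplex x + toComplex y := by
  funext i; simp [toComplex]

theorem toComplex_sub (x y : EuclideanSpace ℝ (Fin d)) :
    toComplex (x - y) = toComplex x - toComplex y := by
  funext i; simp [toComplex]

theorem toComplex_smul (c : ℝ) (x : EuclideanSpace ℝ (Fin d)) :
    toComplex (c • x) = (c : ℂ) • toComplex x := by
  funext i; simp [toComplex]

theorem continuous_toComplex : Continuous (toComplex : EuclideanSpace ℝ (Fin d) → Fin d → ℂ) := by
  unfold toComplex
  fun_prop

theorem re_complexInner (ν : EuclideanSpace ℝ (Fin d)) (z : Fin d → ℂ) :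
    (complexInner ν z).re = inner ℝ ν (reVec z) := by
  simp [complexInner_apply, reVec, PiLp.inner_apply, mul_comm]

theorem im_complexInner (ν : EuclideanSpace ℝ (Fin d)) (z : Fin d → ℂ) :
    (complexInner ν z).im = inner ℝ ν (imVec z) := by
  simp [complexInner_apply, imVec, PiLp.inner_apply, mul_comm]

/-- The hypersurface `{z + H(z) n}` over the complexified hyperplane `p + ν^⊥`: if an entire
function vanishes at its real points, it vanishes on the complexification. -/
theorem eq_zero_on_complex_graph {M : Set (EuclideanSpace ℝ (Fin d))}
    {p ν n : EuclideanSpace ℝ (Fin d)} {ρ : ℝ} {H : (Fin d → ℂ) → ℂ}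
    {h : EuclideanSpace ℝ (Fin d) → ℝ}
    (hH : DifferentiableOn ℂ H (Metric.ball (toComplex p) ρ))
    (hHh : ∀ x, toComplex x ∈ Metric.ball (toComplex p) ρ → H (toComplex x) = h x)
    (hM : ∀ x, toComplex x ∈ Metric.ball (toComplex p) ρ → inner ℝ ν (x - p) = 0 →
      x + h x • n ∈ M)
    {Φ : (Fin d → ℂ) → ℂ} (hΦ : Differentiable ℂ Φ) (hΦM : ∀ x ∈ M, Φ (toComplex x) = 0)
    {ζ : Fin d → ℂ} (hζ : ζ ∈ Metric.ball (toComplex p) ρ)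
    (hζT : complexInner ν (ζ - toComplex p) = 0) :
    Φ (ζ + H ζ • toComplex n) = 0 := by
  set a := reVec ζ with ha
  set b := imVec ζ with hb
  have hab : toComplex a + Complex.I • toComplex b = ζ := toComplex_reVec_add_imVec ζ
  have hTa : inner ℝ ν (a - p) = 0 := by
    have h1 : reVec (ζ - toComplex p) = a - p := by
      ext i; simp [reVec, ha, toComplex]
    rw [← h1, ← re_complexInner, hζT, Complex.zero_re]
  have hTb : inner ℝ ν b = 0 := by
    have h1 : imVec (ζ - toComplex p) = b := by
      ext i; simp [imVec, hb, toComplex]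
    rw [← h1, ← im_complexInner, hζT, Complex.zero_im]
  -- The complex line through the real point `a` in the real direction `b` reaches `ζ` at `τ = i`.
  -- At real `τ` it meets the real hypersurface after lifting by the height, so the identity theorem
  -- on the convex set `D` carries the zeros from real `τ` to `i`.
  let γ : ℂ → Fin d → ℂ := fun τ => toComplex a + τ • toComplex b
  have hγ : Differentiable ℂ γ := by
    intro τ
    exact (differentiableAt_id.smul_const _).const_add _
  let D : Set ℂ := γ ⁻¹' Metric.ball (toComplex p) ρ
  have hDo : IsOpen D := Metric.isOpen_ball.preimage hγ.continuous
  have hDc : Convex ℝ D := by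
    intro x hx y hy s t hs ht hst
    have h1 : γ (s • x + t • y) = s • γ x + t • γ y := by
      funext i
      simp only [γ, Pi.add_apply, Pi.smul_apply, smul_eq_mul, Complex.real_smul]
      have : (s : ℂ) + t = 1 := by exact_mod_cast hst
      linear_combination (-(toComplex a i)) * this
    change γ _ ∈ Metric.ball (toComplex p) ρ
    rw [h1]
    exact convex_ball _ _ hx hy hs ht hst
  -- The centre is real, so passing to real parts coordinatewise does not increase the sup-norm
  -- distance to it.
  have h0D : (0 : ℂ) ∈ D := by
    change γ 0 ∈ Metric.ball (toComplex p) ρ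
    rw [Metric.mem_ball, dist_eq_norm] at hζ ⊢
    refine lt_of_le_of_lt ?_ hζ
    refine (pi_norm_le_iff_of_nonneg (norm_nonneg _)).2 fun i => ?_
    refine le_trans ?_ (norm_le_pi_norm _ i)
    have h2 : (γ 0 - toComplex p) i = (((ζ - toComplex p) i).re : ℂ) := by
      simp [γ, toComplex, ha, reVec]
    rw [h2, Complex.norm_real, Real.norm_eq_abs]
    exact Complex.abs_re_le_norm _
  have hID : Complex.I ∈ D := by
    change γ Complex.I ∈ Metric.ball (toComplex p) ρ
    simpa [γ, hab] using hζ
  let F : ℂ → ℂ := fun τ => Φ (γ τ + H (γ τ) • toComplex n)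
  have hF : AnalyticOnNhd ℂ F D := by
    refine DifferentiableOn.analyticOnNhd ?_ hDo
    have h1 : DifferentiableOn ℂ (fun τ => H (γ τ)) D :=
      hH.comp hγ.differentiableOn fun τ hτ => hτ
    exact hΦ.comp_differentiableOn (hγ.differentiableOn.add (h1.smul_const _))
  have hreal : ∀ s : ℝ, (s : ℂ) ∈ D → F s = 0 := by
    intro s hs
    have h1 : γ s = toComplex (a + s • b) := by
      rw [toComplex_add, toComplex_smul]
    have h2 : toComplex (a + s • b) ∈ Metric.ball (toComplex p) ρ := h1 ▸ hs
    have h3 := hM _ h2 (by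
      rw [add_sub_right_comm, inner_add_right, inner_smul_right, hTa, hTb]; simp)
    have h4 := hΦM _ h3
    rw [toComplex_add, toComplex_smul, ← hHh _ h2] at h4
    simpa [F, h1] using h4
  have hfreq : ∃ᶠ τ in 𝓝[≠] (0 : ℂ), F τ = 0 := by
    have ht : Tendsto (fun s : ℝ => (s : ℂ)) (𝓝[≠] 0) (𝓝[≠] 0) := by
      refine tendsto_nhdsWithin_of_tendsto_nhds_of_eventually_within _ ?_ ?_
      · have := Complex.continuous_ofReal.tendsto 0
        simpa using this.mono_left nhdsWithin_le_nhds
      · filter_upwards [self_mem_nhdsWithin] with s hs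
        simpa using hs
    refine ht.frequently (Eventually.frequently ?_)
    have h1 : ∀ᶠ s : ℝ in 𝓝[≠] 0, (s : ℂ) ∈ D :=
      ht.eventually (mem_nhdsWithin_of_mem_nhds (hDo.mem_nhds h0D))
    exact h1.mono fun s hs => hreal s hs
  have h5 := hF.eqOn_zero_of_preconnected_of_frequently_eq_zero hDc.isPreconnected h0D hfreq hID
  simpa [F, γ, hab] using h5

/-- A non-flat analytic hypersurface has a complex point `z` whose imaginary part is transversal
to its complexification. -/
theorem exists_complex_transversal_point {S : Set (UnitAddTorus (Fin d))}
    (hflat : ¬ IsFlatHypersurface S) :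
    ∃ (G : (Fin d → ℂ) → ℂ) (V : Set (Fin d → ℂ)) (z : Fin d → ℂ), IsOpen V ∧ z ∈ V ∧
      AnalyticOnNhd ℂ G V ∧ G z = 0 ∧ fderiv ℂ G z (toComplex (imVec z)) ≠ 0 ∧
      ∀ Φ : (Fin d → ℂ) → ℂ, Differentiable ℂ Φ →
        (∀ x ∈ torusProj d ⁻¹' S, Φ (toComplex x) = 0) → ∀ z ∈ V, G z = 0 → Φ z = 0 := by
  unfold IsFlatHypersurface at hflat
  push Not at hflat
  obtain ⟨p, hpM, U, g, hg, v, hv, hshape⟩ := hflat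
  set M := torusProj d ⁻¹' S with hMdef
  have hν0 : gradient g p ≠ 0 := hg.gradient_ne_zero p hg.mem
  set ν := gradient g p with hν
  have hνn : ‖ν‖ ≠ 0 := norm_ne_zero_iff.2 hν0
  obtain ⟨n, hνn1⟩ : ∃ n, inner ℝ ν n = 1 := by
    refine ⟨(‖ν‖ ^ 2)⁻¹ • ν, ?_⟩
    rw [inner_smul_right, real_inner_self_eq_norm_sq]
    field_simp
  obtain ⟨h, hha, hp0, hdh, hev⟩ := hg.exists_graph hpM hνn1
  obtain ⟨ρ₀, H, hρ₀, hHa, hHh⟩ := hha.exists_complexification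
  obtain ⟨ε, hε, hball⟩ := Metric.eventually_nhds_iff.1 hev
  set ρ := min ρ₀ (ε / (d + 1)) with hρdef
  have hρ : 0 < ρ := lt_min hρ₀ (by positivity)
  have hsub : Metric.ball (toComplex p) ρ ⊆ Metric.ball (toComplex p) ρ₀ :=
    Metric.ball_subset_ball (min_le_left _ _)
  have hnear : ∀ x, toComplex x ∈ Metric.ball (toComplex p) ρ →
      x + h x • n ∈ U ∧ g (x + h x • n) = inner ℝ ν (x - p) := by
    intro x hx
    refine hball ?_
    rw [Metric.mem_ball, dist_eq_norm, ← toComplex_sub] at hx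
    rw [dist_eq_norm]
    have h1 := norm_le_mul_norm_toComplex (x - p)
    have h2 : ‖toComplex (x - p)‖ < ε / (d + 1) := hx.trans_le (min_le_right _ _)
    rw [lt_div_iff₀ (by positivity)] at h2
    nlinarith [norm_nonneg (toComplex (x - p))]
  have hMgraph : ∀ x, toComplex x ∈ Metric.ball (toComplex p) ρ → inner ℝ ν (x - p) = 0 →
      x + h x • n ∈ M := by
    intro x hx hx0
    obtain ⟨h1, h2⟩ := hnear x hx
    exact (hg.mem_iff _ h1).2 (h2.trans hx0)
  have hpball : toComplex p ∈ Metric.ball (toComplex p) ρ := Metric.mem_ball_self hρ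
  have hevball : ∀ᶠ x in 𝓝 p, toComplex x ∈ Metric.ball (toComplex p) ρ :=
    continuous_toComplex.continuousAt.eventually (Metric.isOpen_ball.mem_nhds hpball)
  -- a tangential direction in which the hypersurface bends
  obtain ⟨x₀, hx₀, hx₀T, hx₀h⟩ : ∃ x, toComplex x ∈ Metric.ball (toComplex p) ρ ∧
      inner ℝ ν (x - p) = 0 ∧ h x ≠ 0 := by
    by_contra! hcon
    refine hshape (shapeOperator_eq_zero_of_eventually_zero hg.isOpen hg.mem hg.analytic hν0 ?_ hv)
    filter_upwards [hevball] with x hx hx0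
    have h1 := hcon x hx hx0
    have h2 := (hnear x hx).2
    rw [h1] at h2
    rw [hx0] at h2
    simpa using h2
  set b := x₀ - p with hb
  let γ : ℂ → Fin d → ℂ := fun t => toComplex p + t • toComplex b
  have hγ : ∀ t, HasDerivAt γ (toComplex b) t := by
    intro t
    simpa [γ] using ((hasDerivAt_id t).smul_const (toComplex b)).const_add (toComplex p)
  have hγ1 : γ 1 = toComplex x₀ := by
    simp [γ, ← toComplex_add, hb]
  have hγ0 : γ 0 = toComplex p := by simp [γ]
  have hb0 : toComplex b ≠ 0 := by
    intro h0
    have h1 : x₀ = p := by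
      have := norm_le_mul_norm_toComplex b
      rw [h0, norm_zero, mul_zero] at this
      exact sub_eq_zero.1 (norm_le_zero_iff.1 this)
    exact hx₀h (by rw [h1, hp0])
  have hbn : 0 < ‖toComplex b‖ := norm_pos_iff.2 hb0
  set R := ρ / ‖toComplex b‖ with hR
  have hγball : ∀ t ∈ Metric.ball (0 : ℂ) R, γ t ∈ Metric.ball (toComplex p) ρ := by
    intro t ht
    rw [mem_ball_zero_iff, hR, lt_div_iff₀ hbn] at ht
    simpa [γ, dist_eq_norm, norm_smul] using ht
  have hHd : ∀ z ∈ Metric.ball (toComplex p) ρ, HasFDerivAt H (fderiv ℂ H z) z :=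
    fun z hz => (hHa z (hsub hz)).differentiableAt.hasFDerivAt
  -- The complexified height along the tangent line through `p` and `x₀`: its one-jet vanishes at 0,
  -- and `k 1 = h x₀` is nonzero.
  let k : ℂ → ℂ := fun t => H (γ t)
  have hkd : ∀ t ∈ Metric.ball (0 : ℂ) R,
      HasDerivAt k (fderiv ℂ H (γ t) (toComplex b)) t := fun t ht =>
    (hHd _ (hγball t ht)).comp_hasDerivAt t (hγ t)
  have hk0 : k 0 = 0 := by
    change H (γ 0) = 0
    rw [hγ0, hHh p (hsub hpball), hp0, Complex.ofReal_zero]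
  have hRpos : 0 < R := by positivity
  have hk1 : deriv k 0 = 0 := by
    have h1 : HasDerivAt k (deriv k 0) ((0 : ℝ) : ℂ) := by
      have := hkd 0 (Metric.mem_ball_self hRpos)
      simpa [this.deriv] using this
    have h2 := h1.comp_ofReal
    have hl : HasDerivAt (fun s : ℝ => p + s • b) b 0 := by
      simpa using ((hasDerivAt_id (0 : ℝ)).smul_const b).const_add p
    have h3 : HasDerivAt (fun s : ℝ => h (p + s • b)) 0 0 := by
      have : HasDerivAt (fun s : ℝ => h (p + s • b)) (fderiv ℝ h p b) 0 := by
        refine HasFDerivAt.comp_hasDerivAt (l := h) (0 : ℝ) ?_ hl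
        simpa using hha.differentiableAt.hasFDerivAt
      simpa [hdh] using this
    have h4 : HasDerivAt (fun s : ℝ => ((h (p + s • b) : ℝ) : ℂ)) ((0 : ℝ) : ℂ) 0 :=
      h3.ofReal_comp
    have h5 : (fun s : ℝ => k s) =ᶠ[𝓝 0] fun s : ℝ => ((h (p + s • b) : ℝ) : ℂ) := by
      have ht : Tendsto (fun s : ℝ => p + s • b) (𝓝 0) (𝓝 p) := by
        simpa using hl.continuousAt.tendsto
      filter_upwards [ht.eventually hevball] with s hs
      have := hHh _ (hsub hs)
      rw [toComplex_add, toComplex_smul] at this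
      exact this
    simpa using h2.unique (h4.congr_of_eventuallyEq h5)
  obtain ⟨t, ht, htne⟩ := exists_im_ne_im_mul_deriv (k := k) (R := R)
    (fun t ht => (hkd t ht).differentiableAt.differentiableWithinAt) hk0 hk1
    ⟨1, by
      rw [mem_ball_zero_iff, hR, lt_div_iff₀ hbn, norm_one, one_mul]
      rw [Metric.mem_ball, dist_eq_norm, ← toComplex_sub] at hx₀
      exact hx₀, by
      change H (γ 1) ≠ 0
      rw [hγ1, hHh _ (hsub hx₀)]
      exact_mod_cast hx₀h⟩
  set ζ := γ t with hζ
  have hζball : ζ ∈ Metric.ball (toComplex p) ρ := hγball t ht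
  -- Projection along `n` onto the complexified tangent plane. With it, `G` below is a defining
  -- function of the complexified graph.
  let π : (Fin d → ℂ) → Fin d → ℂ := fun z => z - complexInner ν (z - toComplex p) • toComplex n
  have hπd : ∀ z, HasFDerivAt π (ContinuousLinearMap.id ℂ _ -
      (complexInner ν).smulRight (toComplex n)) z := by
    intro z
    have h1 : HasFDerivAt (fun z => complexInner ν (z - toComplex p)) (complexInner ν) z := by
      have : HasFDerivAt (fun z => complexInner ν z - complexInner ν (toComplex p))
        (complexInner ν) z := (complexInner ν).hasFDerivAt.sub_const _
      simpa [map_sub] using this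
    exact (hasFDerivAt_id z).sub (h1.smul_const _)
  have hπa : ∀ z, AnalyticAt ℂ π z := by
    intro z
    have h1 : AnalyticAt ℂ (fun z => complexInner ν (z - toComplex p)) z :=
      ((complexInner ν).analyticAt _).comp (analyticAt_id.sub analyticAt_const)
    exact analyticAt_id.sub (h1.smul analyticAt_const)
  have hπc : Continuous π := continuous_iff_continuousAt.2 fun z => (hπd z).continuousAt
  let G : (Fin d → ℂ) → ℂ := fun z => complexInner ν (z - toComplex p) - H (π z)
  let V : Set (Fin d → ℂ) := π ⁻¹' Metric.ball (toComplex p) ρ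
  set z : Fin d → ℂ := ζ + H ζ • toComplex n with hz
  have hn1 : complexInner ν (toComplex n) = 1 := by
    rw [complexInner_toComplex, hνn1, Complex.ofReal_one]
  have hb1 : complexInner ν (toComplex b) = 0 := by
    rw [complexInner_toComplex, hx₀T, Complex.ofReal_zero]
  have hζT : complexInner ν (ζ - toComplex p) = 0 := by
    simp [hζ, γ, hb1]
  have hzT : complexInner ν (z - toComplex p) = H ζ := by
    rw [hz, add_sub_right_comm, map_add, map_smul, hζT, hn1]
    simp
  have hπz : π z = ζ := by
    simp only [π, hzT]
    simp [hz]
  -- As `p`, `b`, `n` are real, `b` is tangential and `⟪ν, n⟫ = 1`, this gives `dG_z(Im z) = Im k(t)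
  -- - Im t * k'(t)`, which is nonzero by the choice of `t`.
  have him : imVec z = t.im • b + (H ζ).im • n := by
    ext i
    simp [imVec, hz, hζ, γ, toComplex]
  refine ⟨G, V, z, Metric.isOpen_ball.preimage hπc, by simpa [V, hπz] using hζball, ?_, ?_, ?_, ?_⟩
  · intro y hy
    have h1 : AnalyticAt ℂ (fun z => complexInner ν (z - toComplex p)) y :=
      ((complexInner ν).analyticAt _).comp (analyticAt_id.sub analyticAt_const)
    exact h1.sub ((hHa _ (hsub hy)).comp (hπa y))
  · change complexInner ν (z - toComplex p) - H (π z) = 0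
    rw [hπz, hzT, sub_self]
  · have h1 : HasFDerivAt (fun z => complexInner ν (z - toComplex p)) (complexInner ν) z := by
      have : HasFDerivAt (fun z => complexInner ν z - complexInner ν (toComplex p))
        (complexInner ν) z := (complexInner ν).hasFDerivAt.sub_const _
      simpa [map_sub] using this
    have h2 : HasFDerivAt (fun z => H (π z)) ((fderiv ℂ H ζ).comp (ContinuousLinearMap.id ℂ _ -
        (complexInner ν).smulRight (toComplex n))) z := by
      refine HasFDerivAt.comp (g := H) (f := π) z ?_ (hπd z)
      rw [hπz]
      exact hHd _ hζball
    have h3 := (h1.sub h2).fderiv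
    change fderiv ℂ G z = _ at h3
    rw [h3, him, toComplex_add, toComplex_smul, toComplex_smul]
    have h4 := (hkd t ht).deriv
    rw [h4] at htne
    have h5 : k t = H ζ := rfl
    rw [h5] at htne
    simp only [ContinuousLinearMap.comp_apply, sub_apply,
      ContinuousLinearMap.smulRight_apply, ContinuousLinearMap.id_apply, map_add, map_smul, hb1, hn1,
      smul_eq_mul, map_sub, zero_smul, map_zero]
    intro h6
    apply htne
    linear_combination h6
  · intro Φ hΦ hΦM y hy hGy
    have h1 : complexInner ν (y - toComplex p) = H (π y) := sub_eq_zero.1 hGy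
    have h2 : y = π y + H (π y) • toComplex n := by
      rw [← h1]; simp [π]
    rw [h2]
    refine eq_zero_on_complex_graph (h := h) (ν := ν)
      (fun z hz => (hHd z hz).differentiableAt.differentiableWithinAt)
      (fun x hx => hHh x (hsub hx)) hMgraph hΦ hΦM hy ?_
    simp only [π, map_sub, map_smul, hn1, smul_eq_mul, mul_one]
    ring

/-- Solving for the complex points `z + W ω` of a hypersurface on real lines in directions `ω`
near a transversal imaginary direction. -/
theorem exists_solution_along_lines {G : (Fin d → ℂ) → ℂ} {V : Set (Fin d → ℂ)} {z : Fin d → ℂ}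
    (hV : IsOpen V) (hzV : z ∈ V) (hG : AnalyticOnNhd ℂ G V) (hGz : G z = 0)
    (htr : fderiv ℂ G z (toComplex (imVec z)) ≠ 0) :
    ∃ (y₀ w : EuclideanSpace ℝ (Fin d)) (r : ℝ), ‖w‖ = 1 ∧ 0 < r ∧
      ∀ ω, dist ω w < r → ∃ W : (Fin d → ℂ) → ℂ,
        DifferentiableOn ℂ W (Metric.ball (toComplex y₀) r) ∧
        ∀ y ∈ Metric.ball (toComplex y₀) r, (W y).im ≤ 0 ∧
          y + W y • toComplex ω ∈ V ∧ G (y + W y • toComplex ω) = 0 := by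
  have him : imVec z ≠ 0 := by
    intro h0
    refine htr ?_
    rw [h0]
    have : toComplex (0 : EuclideanSpace ℝ (Fin d)) = 0 := by funext i; simp [toComplex]
    rw [this, map_zero]
  set m := ‖imVec z‖ with hm
  have hm0 : 0 < m := norm_pos_iff.2 him
  set y₀ := reVec z with hy₀
  -- The sign makes `z = y₀ + W₀ w` with `Im W₀ < 0`, so that frequencies with `⟨ξ - ξ₀, ω⟩ ≤ 0` are
  -- not amplified.
  set w : EuclideanSpace ℝ (Fin d) := -(m⁻¹ • imVec z) with hw
  have hw1 : ‖w‖ = 1 := by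
    rw [hw, norm_neg, norm_smul, ← hm, Real.norm_of_nonneg (by positivity)]
    field_simp
  have hmC : (m : ℂ) ≠ 0 := by exact_mod_cast hm0.ne'
  have hwC : toComplex w = -((m : ℂ)⁻¹ • toComplex (imVec z)) := by
    funext i; simp [hw, toComplex]
  set W₀ : ℂ := -(m * Complex.I) with hW₀
  have hz0 : toComplex y₀ + W₀ • toComplex w = z := by
    conv_rhs => rw [← toComplex_reVec_add_imVec z]
    rw [hwC, hW₀, smul_neg, neg_smul, neg_neg, smul_smul]
    congr 2
    field_simp
  let q : ((Fin d → ℂ) × (Fin d → ℂ)) × ℂ → Fin d → ℂ := fun u => u.1.1 + u.2 • u.1.2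
  let u₀ : ((Fin d → ℂ) × (Fin d → ℂ)) × ℂ := ((toComplex y₀, toComplex w), W₀)
  have hqa : AnalyticAt ℂ q u₀ := by
    refine AnalyticAt.add ?_ (analyticAt_snd.smul ?_)
    · exact analyticAt_fst.comp analyticAt_fst
    · exact analyticAt_snd.comp analyticAt_fst
  have hq0 : q u₀ = z := hz0
  let f : ((Fin d → ℂ) × (Fin d → ℂ)) × ℂ → ℂ := fun u => G (q u)
  have hfa : AnalyticAt ℂ f u₀ := (hG z hzV).comp_of_eq hqa hq0
  have hf0 : f u₀ = 0 := by simp [f, hq0, hGz]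
  have cdf : ContDiffAt ℂ ⊤ f u₀ := hfa.contDiffAt
  -- The derivative of `G (y + W ω)` in the unknown `W` at the base point is `c`, a nonzero multiple
  -- of `dG_z(Im z)`. The implicit function theorem is applied with `(y, ω)` as complex parameters.
  set c : ℂ := fderiv ℂ G z (toComplex w) with hc
  have hc0 : c ≠ 0 := by
    rw [hc, hwC, map_neg, map_smul]
    exact neg_ne_zero.2 (smul_ne_zero (inv_ne_zero hmC) htr)
  have if₂ : (fderiv ℂ f u₀ ∘L .inr ℂ ((Fin d → ℂ) × (Fin d → ℂ)) ℂ).IsInvertible := by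
    refine ⟨ContinuousLinearEquiv.unitsEquivAut ℂ (Units.mk0 c hc0), ?_⟩
    ext
    have hline : HasDerivAt (fun s : ℂ => ((u₀.1, s) : ((Fin d → ℂ) × (Fin d → ℂ)) × ℂ)) (0, 1) W₀ :=
      (hasDerivAt_const _ _).prodMk (hasDerivAt_id _)
    have h1 : HasDerivAt (fun s : ℂ => f (u₀.1, s)) (fderiv ℂ f u₀ (0, 1)) W₀ :=
      HasFDerivAt.comp_hasDerivAt (l := f) W₀ hfa.differentiableAt.hasFDerivAt hline
    have hl : HasDerivAt (fun s : ℂ => toComplex y₀ + s • toComplex w) (toComplex w) W₀ := by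
      simpa using ((hasDerivAt_id W₀).smul_const (toComplex w)).const_add (toComplex y₀)
    have h2 : HasDerivAt (fun s : ℂ => f (u₀.1, s)) c W₀ := by
      refine HasFDerivAt.comp_hasDerivAt (l := G) W₀ ?_ hl
      change HasFDerivAt G (fderiv ℂ G z) (toComplex y₀ + W₀ • toComplex w)
      rw [hz0]
      exact (hG z hzV).differentiableAt.hasFDerivAt
    simpa using h2.unique h1
  have pn : (⊤ : WithTop ℕ∞) ≠ 0 := by simp
  let W := cdf.implicitFunction pn if₂
  have hWp : W u₀.1 = W₀ := cdf.implicitFunction_apply_self pn if₂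
  have hWa : AnalyticAt ℂ W u₀.1 := (cdf.contDiffAt_implicitFunction pn if₂).analyticAt
  have hev : ∀ᶠ x in 𝓝 u₀.1, f (x, W x) = f u₀ := cdf.eventually_apply_implicitFunction pn if₂
  have hevV : ∀ᶠ x in 𝓝 u₀.1, q (x, W x) ∈ V := by
    have hcont : ContinuousAt (fun x => q (x, W x)) u₀.1 := by
      refine ContinuousAt.comp (g := q) (f := fun x => (x, W x)) ?_
        (continuousAt_id.prodMk hWa.continuousAt)
      rw [hWp]
      exact hqa.continuousAt
    refine hcont.eventually (hV.mem_nhds ?_)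
    change q (u₀.1, W u₀.1) ∈ V
    rw [hWp]
    exact hq0 ▸ hzV
  have hevI : ∀ᶠ x in 𝓝 u₀.1, (W x).im < 0 := by
    have hcont : ContinuousAt (fun x => (W x).im) u₀.1 :=
      Complex.continuous_im.continuousAt.comp hWa.continuousAt
    refine hcont.eventually (gt_mem_nhds ?_)
    simp [hWp, hW₀, hm0]
  -- A single neighbourhood in `(y, ω)` makes the ball in `y` independent of `ω`.
  obtain ⟨r, hr, hball⟩ := Metric.eventually_nhds_iff.1
    ((hWa.eventually_analyticAt.and hev).and (hevV.and hevI))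
  refine ⟨y₀, w, r, hw1, hr, fun ω hω => ⟨fun y => W (y, toComplex ω), ?_, ?_⟩⟩
  all_goals
    have hωr : dist (toComplex ω) (toComplex w) < r := by
      rw [dist_eq_norm, ← toComplex_sub]
      rw [dist_eq_norm] at hω
      exact (norm_toComplex_le _).trans_lt hω
    have hin : ∀ y ∈ Metric.ball (toComplex y₀) r, dist (y, toComplex ω) u₀.1 < r := by
      intro y hy
      rw [Prod.dist_eq]
      exact max_lt hy hωr
  · intro y hy
    have h1 := (hball (hin y hy)).1.1.differentiableAt
    refine DifferentiableAt.differentiableWithinAt ?_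
    exact DifferentiableAt.comp (g := W) (f := fun y => (y, toComplex ω)) y h1
      (differentiableAt_id.prodMk (differentiableAt_const _))
  · intro y hy
    obtain ⟨⟨_, h1⟩, h2, h3⟩ := hball (hin y hy)
    exact ⟨h3.le, h2, h1.trans hf0⟩

/-- A non-flat analytic hypersurface `S` has, on every real line in a direction near `w` through a
point near `y₀`, a complex point depending holomorphically on the line; the entire functions
vanishing on `S` vanish there. -/
theorem exists_complex_points_along_lines {S : Set (UnitAddTorus (Fin d))}
    (hflat : ¬ IsFlatHypersurface S) :
    ∃ (y₀ w : EuclideanSpace ℝ (Fin d)) (r : ℝ), ‖w‖ = 1 ∧ 0 < r ∧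
      ∀ ω, dist ω w < r → ∃ W : (Fin d → ℂ) → ℂ,
        DifferentiableOn ℂ W (Metric.ball (toComplex y₀) r) ∧
        (∀ y ∈ Metric.ball (toComplex y₀) r, (W y).im ≤ 0) ∧
        ∀ Φ : (Fin d → ℂ) → ℂ, Differentiable ℂ Φ →
          (∀ x ∈ torusProj d ⁻¹' S, Φ (toComplex x) = 0) →
          ∀ y ∈ Metric.ball (toComplex y₀) r, Φ (y + W y • toComplex ω) = 0 := by
  obtain ⟨G, V, z, hV, hzV, hG, hGz, htr, hvan⟩ := exists_complex_transversal_point hflat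
  obtain ⟨y₀, w, r, hw, hr, hW⟩ := exists_solution_along_lines hV hzV hG hGz htr
  refine ⟨y₀, w, r, hw, hr, fun ω hω => ?_⟩
  obtain ⟨W, hWd, hWp⟩ := hW ω hω
  exact ⟨W, hWd, fun y hy => (hWp y hy).1, fun Φ hΦ hΦM y hy =>
    hvan Φ hΦ hΦM _ (hWp y hy).2.1 (hWp y hy).2.2⟩

end ComplexPoints

/-! ### Fourier series of eigenfunctions on the torus -/

section TorusFourier

open Filter Topology

open MeasureTheory

variable {d : ℕ}

/-- The Haar probability measure of the torus. -/
noncomputable abbrev torusMeasure (d : ℕ) : Measure (UnitAddTorus (Fin d)) :=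
  Measure.pi fun _ : Fin d => AddCircle.haarAddCircle (T := (1 : ℝ))

/-- Continuity and pointwise identities on the torus can thereby be checked on lifts to `ℝ^d`. -/
theorem isOpenQuotientMap_torusProj : IsOpenQuotientMap (torusProj d) := by
  have h1 : IsOpenQuotientMap (Pi.map fun (_ : Fin d) (x : ℝ) => (x : UnitAddCircle)) :=
    IsOpenQuotientMap.piMap fun _ => QuotientAddGroup.isOpenQuotientMap_mk
  have h2 := h1.comp (EuclideanSpace.equiv (Fin d) ℝ).toHomeomorph.isOpenQuotientMap
  exact h2

theorem torusProj_add (x y : EuclideanSpace ℝ (Fin d)) :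
    torusProj d (x + y) = torusProj d x + torusProj d y := by
  funext i; simp [torusProj]

theorem torusProj_neg (x : EuclideanSpace ℝ (Fin d)) :
    torusProj d (-x) = -torusProj d x := by
  funext i; simp [torusProj]

theorem mFourier_torusProj (ξ : Fin d → ℤ) (x : EuclideanSpace ℝ (Fin d)) :
    UnitAddTorus.mFourier ξ (torusProj d x) =
      Complex.exp (2 * Real.pi * Complex.I * complexInner (latticeVec ξ) (toComplex x)) := by
  simp only [UnitAddTorus.mFourier, ContinuousMap.coe_mk, torusProj, fourier_coe_apply]
  rw [← Complex.exp_sum, complexInner_apply, Finset.mul_sum]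
  congr 1
  refine Finset.sum_congr rfl fun i _ => ?_
  simp [latticeVec, toComplex]
  ring

theorem mFourier_add_point (ξ : Fin d → ℤ) (s t : UnitAddTorus (Fin d)) :
    UnitAddTorus.mFourier ξ (s + t) = UnitAddTorus.mFourier ξ s * UnitAddTorus.mFourier ξ t := by
  obtain ⟨x, rfl⟩ := isOpenQuotientMap_torusProj.surjective s
  obtain ⟨y, rfl⟩ := isOpenQuotientMap_torusProj.surjective t
  rw [← torusProj_add, mFourier_torusProj, mFourier_torusProj, mFourier_torusProj, ← Complex.exp_add,
    toComplex_add, map_add, mul_add]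

theorem mFourierCoeff_eq (φ : UnitAddTorus (Fin d) → ℂ) (ξ : Fin d → ℤ) :
    UnitAddTorus.mFourierCoeff φ ξ =
      ∫ s, UnitAddTorus.mFourier (-ξ) s * φ s ∂torusMeasure d := rfl

theorem norm_mFourier_apply (ξ : Fin d → ℤ) (s : UnitAddTorus (Fin d)) :
    ‖UnitAddTorus.mFourier ξ s‖ = 1 := by
  simp only [UnitAddTorus.mFourier, ContinuousMap.coe_mk, norm_prod, fourier_apply, Circle.norm_coe,
    Finset.prod_const_one]

theorem integrable_of_continuous_torus {E : Type*} [NormedAddCommGroup E]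
    {f : UnitAddTorus (Fin d) → E} (hf : Continuous f) : Integrable f (torusMeasure d) := by
  rw [← integrableOn_univ]
  exact hf.continuousOn.integrableOn_compact isCompact_univ

/-- The Fourier coefficients of a directional derivative. -/
theorem mFourierCoeff_of_hasDerivAt {f f' : UnitAddTorus (Fin d) → ℂ} (hf : Continuous f)
    (hf' : Continuous f') (v : EuclideanSpace ℝ (Fin d))
    (hd : ∀ x, HasDerivAt (fun t : ℝ => f (torusProj d (x + t • v))) (f' (torusProj d x)) 0)
    (ξ : Fin d → ℤ) :
    UnitAddTorus.mFourierCoeff f' ξ =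
      2 * Real.pi * Complex.I * ((inner ℝ (latticeVec ξ) v : ℝ) : ℂ) *
        UnitAddTorus.mFourierCoeff f ξ := by
  have hcurve : ∀ t : ℝ, ∀ x, HasDerivAt (fun t : ℝ => f (torusProj d (x + t • v)))
      (f' (torusProj d (x + t • v))) t := by
    intro t x
    have h1 := hd (x + t • v)
    have h1' : HasDerivAt (fun s : ℝ => f (torusProj d (x + t • v + s • v)))
        (f' (torusProj d (x + t • v))) (t - t) := by rw [sub_self]; exact h1
    refine (h1'.comp_sub_const t t).congr_of_eventuallyEq (Eventually.of_forall fun u => ?_)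
    change f (torusProj d (x + u • v)) = f (torusProj d (x + t • v + (u - t) • v))
    congr 2
    rw [sub_smul]
    abel
  obtain ⟨C, hC⟩ : ∃ C, ∀ s, ‖f' s‖ ≤ C := by
    obtain ⟨C, hC⟩ := (isCompact_range hf').isBounded.exists_norm_le
    exact ⟨C, fun s => hC _ ⟨s, rfl⟩⟩
  -- Instead of integrating by parts, the Fourier coefficient of the translate by `t • v` is
  -- differentiated in two ways: under the integral sign here, and below after translation
  -- invariance has turned it into `e(t ⟪ξ, v⟫)` times a constant.
  have hJ : HasDerivAt (fun t : ℝ => ∫ s, UnitAddTorus.mFourier (-ξ) s *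
        f (s + torusProj d (t • v)) ∂torusMeasure d)
      (∫ s, UnitAddTorus.mFourier (-ξ) s * f' (s + torusProj d ((0 : ℝ) • v)) ∂torusMeasure d) 0 := by
    refine (hasDerivAt_integral_of_dominated_loc_of_deriv_le (bound := fun _ => C)
      (F' := fun t s => UnitAddTorus.mFourier (-ξ) s * f' (s + torusProj d (t • v)))
      (s := Set.univ) univ_mem ?_ ?_ ?_ ?_ (integrable_const _) ?_).2
    · refine Eventually.of_forall fun t => Continuous.aestronglyMeasurable ?_
      fun_prop
    · refine integrable_of_continuous_torus ?_
      fun_prop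
    · refine Continuous.aestronglyMeasurable ?_
      fun_prop
    · refine Eventually.of_forall fun s t _ => ?_
      rw [norm_mul, norm_mFourier_apply, one_mul]
      exact hC _
    · refine Eventually.of_forall fun s t _ => ?_
      obtain ⟨x, rfl⟩ := isOpenQuotientMap_torusProj.surjective s
      have := hcurve t x
      simp only [torusProj_add] at this
      exact this.const_mul _
  have hJ2 : ∀ t : ℝ, (∫ s, UnitAddTorus.mFourier (-ξ) s * f (s + torusProj d (t • v))
      ∂torusMeasure d) = Complex.exp (2 * Real.pi * Complex.I *
        ((inner ℝ (latticeVec ξ) v : ℝ) : ℂ) * t) * UnitAddTorus.mFourierCoeff f ξ := by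
    intro t
    have hinv := integral_add_right_eq_self (μ := torusMeasure d)
      (fun s => UnitAddTorus.mFourier (-ξ) s * f s) (torusProj d (t • v))
    rw [mFourierCoeff_eq, ← hinv, ← integral_const_mul]
    refine integral_congr_ae (Eventually.of_forall fun s => ?_)
    simp only
    rw [mFourier_add_point, mFourier_torusProj, toComplex_smul, map_smul, complexInner_toComplex]
    have h1 : ((inner ℝ (latticeVec (-ξ)) v : ℝ) : ℂ) = -((inner ℝ (latticeVec ξ) v : ℝ) : ℂ) := by
      have : latticeVec (-ξ) = -latticeVec ξ := by ext i; simp [latticeVec]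
      rw [this, inner_neg_left]
      simp
    rw [h1, smul_eq_mul]
    set c := ((inner ℝ (latticeVec ξ) v : ℝ) : ℂ)
    have h2 : Complex.exp (2 * Real.pi * Complex.I * c * t) *
        Complex.exp (2 * Real.pi * Complex.I * (t * -c)) = 1 := by
      rw [← Complex.exp_add]
      ring_nf
      simp
    linear_combination (-UnitAddTorus.mFourier (-ξ) s * f (s + torusProj d (t • v))) * h2
  have hexp : HasDerivAt (fun t : ℝ => Complex.exp (2 * Real.pi * Complex.I *
        ((inner ℝ (latticeVec ξ) v : ℝ) : ℂ) * t) * UnitAddTorus.mFourierCoeff f ξ)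
      (2 * Real.pi * Complex.I * ((inner ℝ (latticeVec ξ) v : ℝ) : ℂ) *
        UnitAddTorus.mFourierCoeff f ξ) 0 := by
    have h1 : HasDerivAt (fun t : ℂ => Complex.exp (2 * Real.pi * Complex.I *
        ((inner ℝ (latticeVec ξ) v : ℝ) : ℂ) * t)) (2 * Real.pi * Complex.I *
        ((inner ℝ (latticeVec ξ) v : ℝ) : ℂ)) ((0 : ℝ) : ℂ) := by
      simpa using ((hasDerivAt_id ((0 : ℝ) : ℂ)).const_mul (2 * Real.pi * Complex.I *
        ((inner ℝ (latticeVec ξ) v : ℝ) : ℂ))).cexp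
    exact h1.comp_ofReal.mul_const _
  simp_rw [hJ2] at hJ
  have h0 : torusProj d ((0 : ℝ) • v) = 0 := by funext i; simp [torusProj]
  simp only [h0, add_zero] at hJ
  exact hJ.unique hexp

/-- A periodic continuous function descends to the torus. -/
theorem exists_descent {E : Type*} [TopologicalSpace E] {F : EuclideanSpace ℝ (Fin d) → E}
    (hF : Continuous F) (hper : ∀ x y, torusProj d x = torusProj d y → F x = F y) :
    ∃ f : UnitAddTorus (Fin d) → E, Continuous f ∧ ∀ x, f (torusProj d x) = F x := by
  have hq := (isOpenQuotientMap_torusProj (d := d)).isQuotientMap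
  let f := Function.surjInv hq.surjective
  have hf : ∀ x, F (f (torusProj d x)) = F x := fun x =>
    hper _ _ (Function.surjInv_eq hq.surjective _)
  refine ⟨fun s => F (f s), ?_, hf⟩
  rw [hq.continuous_iff]
  exact hF.congr fun x => (hf x).symm

/-- The derivative of a periodic function is periodic, so it descends to the torus and the operation
can be iterated. -/
theorem exists_directional_derivative {f : UnitAddTorus (Fin d) → ℂ}
    (hf : ContDiff ℝ 1 (f ∘ torusProj d)) (v : EuclideanSpace ℝ (Fin d)) :
    ∃ f' : UnitAddTorus (Fin d) → ℂ, Continuous f' ∧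
      (∀ x, f' (torusProj d x) = fderiv ℝ (f ∘ torusProj d) x v) ∧
      ∀ ξ, UnitAddTorus.mFourierCoeff f' ξ =
        2 * Real.pi * Complex.I * ((inner ℝ (latticeVec ξ) v : ℝ) : ℂ) *
          UnitAddTorus.mFourierCoeff f ξ := by
  have hdiff : Differentiable ℝ (f ∘ torusProj d) := hf.differentiable (by norm_num)
  obtain ⟨f', hf'c, hf'⟩ := exists_descent (F := fun x => fderiv ℝ (f ∘ torusProj d) x v)
    ((hf.continuous_fderiv (by norm_num)).clm_apply continuous_const) (by
      intro x y hxy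
      have h1 : (fun z => (f ∘ torusProj d) (z + (y - x))) = f ∘ torusProj d := by
        funext z
        simp only [Function.comp_apply]
        rw [sub_eq_add_neg, torusProj_add, torusProj_add, torusProj_neg, hxy, add_neg_cancel,
          add_zero]
      have h2 := fderiv_comp_add_right (𝕜 := ℝ) (f := f ∘ torusProj d) (x := x) (y - x)
      rw [h1, add_sub_cancel] at h2
      rw [h2])
  refine ⟨f', hf'c, hf', fun ξ => mFourierCoeff_of_hasDerivAt ?_ hf'c v (fun x => ?_) ξ⟩
  · exact isOpenQuotientMap_torusProj.isQuotientMap.continuous_iff.2 hf.continuous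
  · rw [hf']
    have hl : HasDerivAt (fun t : ℝ => x + t • v) v 0 := by
      simpa using ((hasDerivAt_id (0 : ℝ)).smul_const v).const_add x
    refine HasFDerivAt.comp_hasDerivAt (l := f ∘ torusProj d) (0 : ℝ) ?_ hl
    simpa using (hdiff x).hasFDerivAt

theorem IsTorusEigenfunction.continuous {lam : ℝ} {φ : UnitAddTorus (Fin d) → ℂ}
    (hφ : IsTorusEigenfunction lam φ) : Continuous φ :=
  isOpenQuotientMap_torusProj.isQuotientMap.continuous_iff.2 hφ.contDiff.continuous

theorem norm_latticeVec_sq (ξ : Fin d → ℤ) : ‖latticeVec ξ‖ ^ 2 = ∑ i, (ξ i : ℝ) ^ 2 := by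
  simp [EuclideanSpace.norm_sq_eq, latticeVec]

/-- The Fourier coefficients of an eigenfunction are supported on a sphere. -/
theorem IsTorusEigenfunction.mFourierCoeff_eq_zero {lam : ℝ} {φ : UnitAddTorus (Fin d) → ℂ}
    (hφ : IsTorusEigenfunction lam φ) (hlam : 0 < lam) {ξ : Fin d → ℤ}
    (hξ : ‖latticeVec ξ‖ ≠ lam) : UnitAddTorus.mFourierCoeff φ ξ = 0 := by
  let e : Fin d → EuclideanSpace ℝ (Fin d) := fun i => EuclideanSpace.basisFun (Fin d) ℝ i
  have hC2 := hφ.contDiff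
  choose f hfc hf hfξ using fun i => exists_directional_derivative (hC2.of_le one_le_two) (e i)
  have hf1 : ∀ i, f i ∘ torusProj d = fun x => fderiv ℝ (φ ∘ torusProj d) x (e i) := fun i =>
    funext fun x => hf i x
  have hfd : ContDiff ℝ 1 (fderiv ℝ (φ ∘ torusProj d)) :=
    hC2.fderiv_right (by norm_num)
  have hfC : ∀ i, ContDiff ℝ 1 (f i ∘ torusProj d) := by
    intro i
    rw [hf1]
    exact hfd.clm_apply contDiff_const
  choose g hgc hg hgξ using fun i => exists_directional_derivative (hfC i) (e i)
  have hsum : ∀ s, ∑ i, g i s = -((4 * Real.pi ^ 2 * lam ^ 2 : ℝ) : ℂ) * φ s := by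
    intro s
    obtain ⟨x, rfl⟩ := isOpenQuotientMap_torusProj.surjective s
    have h1 := hφ.eigen x
    rw [InnerProductSpace.laplacian_eq_iteratedFDeriv_orthonormalBasis _
      (EuclideanSpace.basisFun (Fin d) ℝ)] at h1
    have h2 : ∀ i, g i (torusProj d x) = iteratedFDeriv ℝ 2 (φ ∘ torusProj d) x
        ![EuclideanSpace.basisFun (Fin d) ℝ i, EuclideanSpace.basisFun (Fin d) ℝ i] := by
      intro i
      rw [hg, hf1, iteratedFDeriv_two_apply]
      have h3 : HasFDerivAt (fun x => fderiv ℝ (φ ∘ torusProj d) x (e i))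
          ((ContinuousLinearMap.apply ℝ ℂ (e i)).comp
            (fderiv ℝ (fderiv ℝ (φ ∘ torusProj d)) x)) x :=
        (ContinuousLinearMap.apply ℝ ℂ (e i)).hasFDerivAt.comp x
          ((hfd.differentiable (by norm_num)) x).hasFDerivAt
      rw [h3.fderiv]
      rfl
    rw [Finset.sum_congr rfl fun i _ => h2 i]
    simp only [Function.comp_apply] at h1
    linear_combination -h1
  -- Taking Fourier coefficients in `Σ ∂ᵢ² φ = -4π²λ² φ` leads to `(|ξ|² - λ²) a_ξ = 0`.
  have hint : ∑ i, UnitAddTorus.mFourierCoeff (g i) ξ =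
      -((4 * Real.pi ^ 2 * lam ^ 2 : ℝ) : ℂ) * UnitAddTorus.mFourierCoeff φ ξ := by
    simp only [mFourierCoeff_eq]
    rw [← integral_finsetSum, ← integral_const_mul]
    · refine integral_congr_ae (Eventually.of_forall fun s => ?_)
      simp only
      rw [← Finset.mul_sum, hsum]
      ring
    · intro i _
      have := hgc i
      refine integrable_of_continuous_torus ?_
      fun_prop
  have hinner : ∀ i, inner ℝ (latticeVec ξ) (e i) = (ξ i : ℝ) := by
    intro i
    simp [e, latticeVec, EuclideanSpace.basisFun_apply, EuclideanSpace.inner_single_right]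
  simp_rw [hgξ, hfξ, hinner] at hint
  have h4 : ((‖latticeVec ξ‖ ^ 2 : ℝ) : ℂ) = ∑ i, (ξ i : ℂ) ^ 2 := by
    rw [norm_latticeVec_sq]
    push_cast
    rfl
  have h5 : ∑ i, 2 * (Real.pi : ℂ) * Complex.I * ((ξ i : ℝ) : ℂ) * (2 * Real.pi * Complex.I *
      ((ξ i : ℝ) : ℂ) * UnitAddTorus.mFourierCoeff φ ξ) =
      -(4 * (Real.pi : ℂ) ^ 2) * ((‖latticeVec ξ‖ ^ 2 : ℝ) : ℂ) *
        UnitAddTorus.mFourierCoeff φ ξ := by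
    rw [h4, Finset.mul_sum, Finset.sum_mul]
    refine Finset.sum_congr rfl fun i _ => ?_
    push_cast
    linear_combination (4 * (Real.pi : ℂ) ^ 2 * (ξ i : ℂ) ^ 2 *
      UnitAddTorus.mFourierCoeff φ ξ) * Complex.I_sq
  rw [h5] at hint
  have h6 : (((‖latticeVec ξ‖ ^ 2 - lam ^ 2) * (4 * Real.pi ^ 2) : ℝ) : ℂ) *
      UnitAddTorus.mFourierCoeff φ ξ = 0 := by
    push_cast at hint ⊢
    linear_combination -hint
  refine (mul_eq_zero.1 h6).resolve_left ?_
  rw [Complex.ofReal_eq_zero]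
  refine mul_ne_zero ?_ (by positivity)
  intro h7
  apply hξ
  nlinarith [norm_nonneg (latticeVec ξ), sq_nonneg (‖latticeVec ξ‖ - lam)]

open Classical in
/-- The integer points on the sphere of radius `lam`. -/
noncomputable def sphereLattice (d : ℕ) (lam : ℝ) : Finset (Fin d → ℤ) :=
  (Fintype.piFinset fun _ => Finset.Icc (-⌊lam⌋) ⌊lam⌋).filter fun ξ => ‖latticeVec ξ‖ = lam

theorem abs_le_norm_latticeVec (ξ : Fin d → ℤ) (i : Fin d) : |(ξ i : ℝ)| ≤ ‖latticeVec ξ‖ := by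
  simpa [latticeVec] using PiLp.norm_apply_le (latticeVec ξ) i

theorem mem_sphereLattice {lam : ℝ} {ξ : Fin d → ℤ} :
    ξ ∈ sphereLattice d lam ↔ ‖latticeVec ξ‖ = lam := by
  classical
  simp only [sphereLattice, Finset.mem_filter, Fintype.mem_piFinset, Finset.mem_Icc,
    and_iff_right_iff_imp]
  intro h i
  have h1 := abs_le.1 (abs_le_norm_latticeVec ξ i)
  rw [h] at h1
  constructor
  · rw [neg_le]
    exact Int.le_floor.2 (by push_cast; linarith)
  · exact Int.le_floor.2 h1.2

/-- All coordinates lie in `[-λ, λ]`. This polynomial bound is harmless against the exponential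
gain. -/
theorem card_sphereLattice_le {lam : ℝ} (hlam : 0 ≤ lam) :
    ((sphereLattice d lam).card : ℝ) ≤ (2 * lam + 1) ^ d := by
  classical
  have h1 : (sphereLattice d lam).card ≤
      (Fintype.piFinset fun _ : Fin d => Finset.Icc (-⌊lam⌋) ⌊lam⌋).card :=
    Finset.card_filter_le _ _
  rw [Fintype.card_piFinset] at h1
  simp only [Int.card_Icc, Finset.prod_const, Finset.card_univ, Fintype.card_fin] at h1
  refine (Nat.cast_le.2 h1).trans ?_
  push_cast
  gcongr
  have h2 : 0 ≤ ⌊lam⌋ := Int.floor_nonneg.2 hlam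
  have h3 : (((⌊lam⌋ + 1 - -⌊lam⌋).toNat : ℤ) : ℝ) = ((⌊lam⌋ + 1 - -⌊lam⌋ : ℤ) : ℝ) := by
    rw [Int.toNat_of_nonneg (by omega)]
  rw [Int.cast_natCast] at h3
  rw [h3]
  push_cast
  linarith [Int.floor_le lam]

/-- An eigenfunction is a trigonometric polynomial with frequencies on a sphere. -/
theorem IsTorusEigenfunction.eq_sum {lam : ℝ} {φ : UnitAddTorus (Fin d) → ℂ}
    (hφ : IsTorusEigenfunction lam φ) (hlam : 0 < lam) (x : EuclideanSpace ℝ (Fin d)) :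
    φ (torusProj d x) = ∑ ξ ∈ sphereLattice d lam, UnitAddTorus.mFourierCoeff φ ξ *
      Complex.exp (2 * Real.pi * Complex.I * complexInner (latticeVec ξ) (toComplex x)) := by
  let F : C(UnitAddTorus (Fin d), ℂ) := ⟨φ, hφ.continuous⟩
  have hz : ∀ ξ ∉ sphereLattice d lam, UnitAddTorus.mFourierCoeff φ ξ = 0 := fun ξ hξ =>
    hφ.mFourierCoeff_eq_zero hlam fun h => hξ (mem_sphereLattice.2 h)
  -- Finite support makes the Fourier series summable, so it represents the continuous function `φ`
  -- at every point.
  have hs : Summable (UnitAddTorus.mFourierCoeff F) := summable_of_ne_finset_zero hz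
  have h1 := UnitAddTorus.hasSum_mFourier_series_apply_of_summable hs (torusProj d x)
  have h2 : HasSum (fun ξ => UnitAddTorus.mFourierCoeff F ξ •
      UnitAddTorus.mFourier ξ (torusProj d x)) (∑ ξ ∈ sphereLattice d lam,
        UnitAddTorus.mFourierCoeff F ξ • UnitAddTorus.mFourier ξ (torusProj d x)) :=
    hasSum_sum_of_ne_finset_zero fun ξ hξ => by
      rw [show UnitAddTorus.mFourierCoeff F ξ = 0 from hz ξ hξ, zero_smul]
  have h3 := h1.unique h2
  simp only [mFourier_torusProj, smul_eq_mul] at h3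
  exact h3

/-- The Haar measure has mass 1, so Jensen's inequality bounds the `L¹` norm by the `L²` norm. -/
theorem norm_mFourierCoeff_le {φ : UnitAddTorus (Fin d) → ℂ} (hφ : Continuous φ)
    (ξ : Fin d → ℤ) : ‖UnitAddTorus.mFourierCoeff φ ξ‖ ≤ torusL2Norm φ := by
  rw [mFourierCoeff_eq, torusL2Norm]
  refine (norm_integral_le_integral_norm _).trans ?_
  simp only [norm_mul, norm_mFourier_apply, one_mul]
  refine Real.le_sqrt_of_sq_le ?_
  have h1 : ConvexOn ℝ Set.univ fun x : ℝ => x ^ 2 := even_two.convexOn_pow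
  exact h1.map_integral_le (μ := torusMeasure d) (f := fun s => ‖φ s‖)
    (by fun_prop) isClosed_univ (by simp)
    (integrable_of_continuous_torus (by fun_prop)) (integrable_of_continuous_torus (by fun_prop))

end TorusFourier

/-! ### Isolated clusters of integer points on spheres -/

section LatticeClusters

open Filter Topology

variable {d : ℕ}

theorem latticeVec_sub (ξ η : Fin d → ℤ) : latticeVec (ξ - η) = latticeVec ξ - latticeVec η := by
  ext i; simp [latticeVec]

theorem inner_latticeVec (ξ η : Fin d → ℤ) :
    inner ℝ (latticeVec ξ) (latticeVec η) = ((∑ i, ξ i * η i : ℤ) : ℝ) := by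
  simp [latticeVec, PiLp.inner_apply, mul_comm]

/-- A vector in the span of short integer vectors, with small inner products with them, is
short. -/
theorem norm_le_of_mem_span_latticeVec {s : Set (EuclideanSpace ℝ (Fin d))} {R : ℝ} (hR : 1 ≤ R)
    (hs : ∀ v ∈ s, ∃ ξ : Fin d → ℤ, v = latticeVec ξ) (hsR : ∀ v ∈ s, ‖v‖ ≤ R)
    {p : EuclideanSpace ℝ (Fin d)} (hp : p ∈ Submodule.span ℝ s)
    (hps : ∀ v ∈ s, |inner ℝ v p| ≤ R ^ 2) :
    ‖p‖ ≤ d * d.factorial * R ^ (2 * d + 1) := by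
  obtain ⟨k, f, hkd, hfs, hspan, hli⟩ : ∃ (k : ℕ) (f : Fin k → EuclideanSpace ℝ (Fin d)), k ≤ d ∧
      (∀ i, f i ∈ s) ∧ Submodule.span ℝ (Set.range f) = Submodule.span ℝ s ∧
      LinearIndependent ℝ f := by
    obtain ⟨f, hf⟩ := Submodule.exists_fun_fin_finrank_span_eq ℝ s
    have := Submodule.finrank_le (Submodule.span ℝ s)
    rw [finrank_euclideanSpace_fin] at this
    exact ⟨_, f, this, hf⟩
  choose ξ hξ using fun i => hs (f i) (hfs i)
  -- The Gram matrix of a basis of integer vectors has a nonzero integer determinant, hence `|det| ≥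
  -- 1`. Cramer's rule then bounds the coordinates of `p` by determinants with entries at most `R ^
  -- 2`.
  let A : Matrix (Fin k) (Fin k) ℝ := Matrix.gram ℝ f
  let AZ : Matrix (Fin k) (Fin k) ℤ := Matrix.of fun i j => ∑ l, ξ i l * ξ j l
  have hA : A = AZ.map (Int.castRingHom ℝ) := by
    ext i j
    simp only [A, AZ, Matrix.gram_apply, Matrix.map_apply, Matrix.of_apply]
    rw [hξ i, hξ j, inner_latticeVec]
    rfl
  have hdetA : A.det = (AZ.det : ℝ) := by
    rw [hA, ← RingHom.mapMatrix_apply, ← RingHom.map_det]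
    rfl
  have hdet0 : A.det ≠ 0 := Matrix.det_gram_ne_zero_iff_linearIndependent.2 hli
  have hdet1 : 1 ≤ |A.det| := by
    rw [hdetA] at hdet0 ⊢
    have : AZ.det ≠ 0 := by exact_mod_cast hdet0
    exact_mod_cast Int.one_le_abs this
  rw [← hspan] at hp
  obtain ⟨c, hc⟩ := (Submodule.mem_span_range_iff_exists_fun ℝ).1 hp
  let b : Fin k → ℝ := fun i => inner ℝ (f i) p
  have hAc : A.mulVec c = b := by
    funext i
    simp only [A, b, Matrix.mulVec, dotProduct, Matrix.gram_apply, ← hc, inner_sum,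
      inner_smul_right]
    exact Finset.sum_congr rfl fun j _ => mul_comm _ _
  have hcr : A.cramer b = A.det • c := by
    rw [← hAc, Matrix.cramer_eq_adjugate_mulVec, Matrix.mulVec_mulVec, Matrix.adjugate_mul,
      Matrix.smul_mulVec, Matrix.one_mulVec]
  have hentry : ∀ i j, |A i j| ≤ R ^ 2 := by
    intro i j
    refine (abs_real_inner_le_norm (f i) (f j)).trans ?_
    rw [sq]
    exact mul_le_mul (hsR _ (hfs i)) (hsR _ (hfs j)) (norm_nonneg _) (by linarith)
  have hcbound : ∀ j, |c j| ≤ d.factorial * R ^ (2 * d) := by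
    intro j
    have h1 : |(A.cramer b) j| ≤ k.factorial * (R ^ 2) ^ k := by
      rw [Matrix.cramer_apply]
      have := Matrix.det_le (A := A.updateCol j b) (abv := AbsoluteValue.abs) (x := R ^ 2) (by
        intro i l
        rw [AbsoluteValue.abs_apply, Matrix.updateCol_apply]
        split_ifs
        · exact hps _ (hfs i)
        · exact hentry i l)
      simpa using this
    rw [hcr, Pi.smul_apply, smul_eq_mul, abs_mul] at h1
    calc |c j| ≤ |A.det| * |c j| := le_mul_of_one_le_left (abs_nonneg _) hdet1
      _ ≤ k.factorial * (R ^ 2) ^ k := h1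
      _ ≤ d.factorial * R ^ (2 * d) := by
        rw [← pow_mul]
        gcongr
  calc ‖p‖ = ‖∑ j, c j • f j‖ := by rw [hc]
    _ ≤ ∑ _j : Fin k, (d.factorial * R ^ (2 * d)) * R := by
      refine norm_sum_le_of_le _ fun j _ => ?_
      rw [norm_smul, Real.norm_eq_abs]
      exact mul_le_mul (hcbound j) (hsR _ (hfs j)) (norm_nonneg _) (by positivity)
    _ = k * (d.factorial * R ^ (2 * d) * R) := by simp
    _ ≤ d * (d.factorial * R ^ (2 * d) * R) := by gcongr
    _ = d * d.factorial * R ^ (2 * d + 1) := by ring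

/-- In an increasing sequence of subspaces of `ℝ^d`, two consecutive ones among the first `d + 2`
coincide. -/
theorem exists_submodule_eq_succ {V : ℕ → Submodule ℝ (EuclideanSpace ℝ (Fin d))}
    (hV : Monotone V) : ∃ j ≤ d, V j = V (j + 1) := by
  by_contra! hcon
  have h1 : ∀ j ≤ d + 1, j ≤ Module.finrank ℝ (V j) := by
    intro j
    induction j with
    | zero => simp
    | succ j ih =>
      intro hj
      have h2 := ih (by omega)
      have h3 : V j < V (j + 1) := lt_of_le_of_ne (hV (Nat.le_succ j)) (hcon j (by omega))
      have h4 := Submodule.finrank_lt_finrank_of_lt h3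
      omega
  have h2 := h1 (d + 1) le_rfl
  have h3 := Submodule.finrank_le (V (d + 1))
  rw [finrank_euclideanSpace_fin] at h3
  omega

/-- The differences `ξ - ξ₀` of length at most `R`, for `ξ` in the set `E`. -/
def shortDifferences (E : Finset (Fin d → ℤ)) (ξ₀ : Fin d → ℤ) (R : ℝ) :
    Set (EuclideanSpace ℝ (Fin d)) :=
  {v | ∃ ξ ∈ E, v = latticeVec (ξ - ξ₀) ∧ ‖v‖ ≤ R}

/-- If the integer points of the sphere within distances `R` and `R'` of `ξ₀` span the same affine
subspace, those within `R'` form an isolated cluster in a hyperplane section with pole `ω`. -/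
theorem exists_pole_of_span_eq {lam R R' : ℝ} {ξ₀ : Fin d → ℤ} (hR : 1 ≤ R)
    (hξ₀ : ξ₀ ∈ sphereLattice d lam)
    (hspan : Submodule.span ℝ (shortDifferences (sphereLattice d lam) ξ₀ R) =
      Submodule.span ℝ (shortDifferences (sphereLattice d lam) ξ₀ R'))
    (hB : 2 * (d * d.factorial * R ^ (2 * d + 1)) ≤ R')
    (hBlam : d * d.factorial * R ^ (2 * d + 1) < lam) :
    ∃ ω : EuclideanSpace ℝ (Fin d), ‖ω‖ = 1 ∧
      dist ω (lam⁻¹ • latticeVec ξ₀) ≤ 2 * (d * d.factorial * R ^ (2 * d + 1)) / lam ∧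
      ∀ ξ ∈ sphereLattice d lam,
        (inner ℝ (latticeVec (ξ - ξ₀)) ω = 0 ∧
          ‖latticeVec (ξ - ξ₀)‖ ≤ 2 * (d * d.factorial * R ^ (2 * d + 1))) ∨
        (inner ℝ (latticeVec (ξ - ξ₀)) ω ≤ 0 ∧ R' < ‖latticeVec (ξ - ξ₀)‖) := by
  set B : ℝ := d * d.factorial * R ^ (2 * d + 1) with hBdef
  have hB0 : 0 ≤ B := by positivity
  have hlam : 0 < lam := hB0.trans_lt hBlam
  set s := shortDifferences (sphereLattice d lam) ξ₀ R with hs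
  set V := Submodule.span ℝ s with hV
  set x := latticeVec ξ₀ with hx
  have hxn : ‖x‖ = lam := mem_sphereLattice.1 hξ₀
  -- `x - p` is the point of the affine space `ξ₀ + V` closest to the origin, that is, the centre of
  -- its section of the sphere. The pole is the direction of this centre.
  set p := V.starProjection x with hp
  have hpV : p ∈ V := V.starProjection_apply_mem x
  have hort : ∀ v ∈ V, inner ℝ v (x - p) = 0 := fun v hv =>
    V.sub_starProjection_mem_orthogonal x v hv
  -- Expanding `|ξ₀ + v|² = |ξ₀|²` with `v = ξ - ξ₀`; this bounds the inner products of short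
  -- differences with `p`.
  have hsphere : ∀ ξ ∈ sphereLattice d lam,
      inner ℝ (latticeVec (ξ - ξ₀)) x = -‖latticeVec (ξ - ξ₀)‖ ^ 2 / 2 := by
    intro ξ hξ
    have h1 : ‖latticeVec (ξ - ξ₀) + x‖ ^ 2 = lam ^ 2 := by
      rw [latticeVec_sub, hx, sub_add_cancel, mem_sphereLattice.1 hξ]
    rw [norm_add_sq_real, hxn] at h1
    linarith
  have hpn : ‖p‖ ≤ B := by
    refine norm_le_of_mem_span_latticeVec hR ?_ ?_ hpV ?_
    · rintro v ⟨ξ, _, rfl, _⟩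
      exact ⟨_, rfl⟩
    · rintro v ⟨ξ, _, _, h⟩
      exact h
    · rintro v ⟨ξ, hξ, rfl, h⟩
      have h1 := hort _ (Submodule.subset_span ⟨ξ, hξ, rfl, h⟩)
      rw [inner_sub_right, hsphere ξ hξ] at h1
      have h2 : inner ℝ (latticeVec (ξ - ξ₀)) p = -‖latticeVec (ξ - ξ₀)‖ ^ 2 / 2 := by linarith
      rw [h2, abs_le]
      constructor <;> nlinarith [norm_nonneg (latticeVec (ξ - ξ₀))]
  set c := x - p with hc
  have hcn : |‖c‖ - lam| ≤ B := by
    have := abs_norm_sub_norm_le c x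
    rw [hxn] at this
    refine this.trans ?_
    rw [hc, sub_sub_cancel_left, norm_neg]
    exact hpn
  have hc0 : 0 < ‖c‖ := by linarith [(abs_le.1 hcn).1]
  refine ⟨‖c‖⁻¹ • c, ?_, ?_, ?_⟩
  · rw [norm_smul, norm_inv, norm_norm, inv_mul_cancel₀ hc0.ne']
  · have h1 : ‖c‖⁻¹ • c - lam⁻¹ • x = (‖c‖⁻¹ - lam⁻¹) • c - lam⁻¹ • p := by
      rw [hc]; module
    rw [dist_eq_norm, h1]
    refine (norm_sub_le _ _).trans ?_
    have h2 : ‖(‖c‖⁻¹ - lam⁻¹) • c‖ ≤ B / lam := by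
      rw [norm_smul, Real.norm_eq_abs]
      have h3 : |‖c‖⁻¹ - lam⁻¹| * ‖c‖ = |‖c‖ - lam| / lam := by
        have h4 : ‖c‖⁻¹ - lam⁻¹ = -((‖c‖ - lam) / (‖c‖ * lam)) := by field_simp; ring
        rw [h4, abs_neg, abs_div, abs_of_pos (mul_pos hc0 hlam)]
        field_simp
      rw [h3]
      gcongr
    have h3 : ‖lam⁻¹ • p‖ ≤ B / lam := by
      rw [norm_smul, norm_inv, Real.norm_of_nonneg hlam.le, inv_mul_eq_div]
      gcongr
    calc _ ≤ B / lam + B / lam := add_le_add h2 h3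
      _ = 2 * B / lam := by ring
  · intro ξ hξ
    set v := latticeVec (ξ - ξ₀) with hv
    have hvc : inner ℝ v c = -‖v‖ ^ 2 / 2 - inner ℝ v p := by
      rw [hc, inner_sub_right, hsphere ξ hξ]
    have hvp : |inner ℝ v p| ≤ ‖v‖ * B :=
      (abs_real_inner_le_norm _ _).trans (mul_le_mul_of_nonneg_left hpn (norm_nonneg _))
    -- Since `⟪v, c⟫ = -|v|²/2 - ⟪v, p⟫` and `|p| ≤ B`: if `v` lies in `V`, the left side is 0 and
    -- `|v| ≤ 2B`; if `|v| > R' ≥ 2B`, the quadratic term wins and `⟪v, c⟫ ≤ 0`.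
    by_cases hvR : ‖v‖ ≤ R'
    · left
      have hvV : v ∈ V := by
        rw [hspan]
        exact Submodule.subset_span ⟨ξ, hξ, rfl, hvR⟩
      have h1 := hort v hvV
      refine ⟨by rw [inner_smul_right, h1, mul_zero], ?_⟩
      rw [h1] at hvc
      by_contra! hcon
      have h2 := (abs_le.1 hvp).1
      nlinarith [norm_nonneg v]
    · right
      push Not at hvR
      refine ⟨?_, hvR⟩
      rw [inner_smul_right]
      refine mul_nonpos_of_nonneg_of_nonpos (by positivity) ?_
      rw [hvc]
      have h2 := (abs_le.1 hvp).1
      nlinarith [norm_nonneg v]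

/-- Contour shifts act on one coordinate at a time, so a long vector must be given a long
coordinate. -/
theorem exists_coord_ge {ξ : Fin d → ℤ} {T : ℝ} (hT : 0 < T) (h : d * T < ‖latticeVec ξ‖) :
    ∃ i, T ≤ |(ξ i : ℝ)| := by
  by_contra! hcon
  have h1 : ‖toComplex (latticeVec ξ)‖ ≤ T := by
    refine (pi_norm_le_iff_of_nonneg hT.le).2 fun i => ?_
    simpa [toComplex, latticeVec] using (hcon i).le
  have h2 := norm_le_mul_norm_toComplex (latticeVec ξ)
  have h3 : (d : ℝ) * ‖toComplex (latticeVec ξ)‖ ≤ d * T := by gcongr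
  linarith

/-- Every integer point `ξ₀` of a large sphere lies in a cluster of integer points of diameter `D`,
in a hyperplane section of the sphere with pole close to the direction of `ξ₀`, with distance at
least `D ^ K` to the other integer points, and these lie below the hyperplane. -/
theorem exists_isolated_cluster (d K : ℕ) : ∃ δ : ℝ, 0 < δ ∧ ∃ lam₀ : ℝ, 1 ≤ lam₀ ∧
    ∀ lam ≥ lam₀, ∀ ξ₀ ∈ sphereLattice d lam, ∃ (D : ℕ) (ω : EuclideanSpace ℝ (Fin d)),
      lam ^ δ ≤ D ∧ ‖ω‖ = 1 ∧ dist ω (lam⁻¹ • latticeVec ξ₀) ≤ lam ^ (-(1 / 2) : ℝ) ∧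
      ∀ ξ ∈ sphereLattice d lam,
        (inner ℝ (latticeVec (ξ - ξ₀)) ω = 0 ∧ ∀ i, |((ξ i - ξ₀ i : ℤ) : ℝ)| ≤ D) ∨
        (inner ℝ (latticeVec (ξ - ξ₀)) ω ≤ 0 ∧ ∃ i, (D : ℝ) ^ K ≤ |((ξ i - ξ₀ i : ℤ) : ℝ)|) := by
  -- With `D = ρ j ^ a`, one power beyond `2d + 1` absorbs the constant `2 * d * d!`. The next scale
  -- is `ρ j ^ L = D ^ (K + 1)`, one power beyond `K` to pay for the factor `d` in passing to a
  -- coordinate. Every admissible `D` is at most `m ^ Q`, and `δ = 1 / (4 Q)` with `m ≤ lam ^ (2 δ)`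
  -- keeps it below `lam ^ (1 / 2)`.
  set a := 2 * d + 2 with ha
  set L := a * (K + 1) with hL
  set Q := a * L ^ d with hQ
  have hL1 : 1 ≤ L := Nat.one_le_iff_ne_zero.2 (by positivity)
  have hQ1 : 1 ≤ Q := Nat.one_le_iff_ne_zero.2 (by positivity)
  have hQ0 : (0 : ℝ) < Q := by exact_mod_cast hQ1
  set m₀ : ℕ := 2 * (d * d.factorial) + d + 2 with hm₀
  set δ : ℝ := 1 / (4 * Q) with hδ
  have hδ0 : 0 < δ := by positivity
  refine ⟨δ, hδ0, (m₀ : ℝ) ^ (1 / δ), ?_, ?_⟩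
  · exact Real.one_le_rpow (by exact_mod_cast (by omega : 1 ≤ m₀)) (by positivity)
  intro lam hlam ξ₀ hξ₀
  have hm₀1 : (1 : ℝ) ≤ m₀ := by exact_mod_cast (by omega : 1 ≤ m₀)
  have hlam1 : 1 ≤ lam := (Real.one_le_rpow hm₀1 (by positivity)).trans hlam
  have hlam0 : 0 < lam := by linarith
  set x := lam ^ δ with hx
  have hxm₀ : (m₀ : ℝ) ≤ x := by
    have h1 := Real.rpow_le_rpow (by positivity) hlam hδ0.le
    rwa [← Real.rpow_mul (by positivity), one_div_mul_cancel hδ0.ne', Real.rpow_one] at h1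
  have hx2 : 2 ≤ x := by
    refine le_trans ?_ hxm₀
    exact_mod_cast (by omega : 2 ≤ m₀)
  -- Rounding down `x ^ 2` rather than `x` yields an integer still at least `x = lam ^ δ`.
  set m : ℕ := ⌊x ^ 2⌋₊ with hm
  have hmx : x ≤ m := by
    have := Nat.lt_floor_add_one (x ^ 2)
    rw [← hm] at this
    nlinarith
  have hmx2 : (m : ℝ) ≤ x ^ 2 := Nat.floor_le (by positivity)
  have hmm₀ : m₀ ≤ m := by exact_mod_cast hxm₀.trans hmx
  have hm1 : 1 ≤ m := by omega
  have hmQ : (m : ℝ) ^ Q ≤ lam ^ (1 / 2 : ℝ) := by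
    calc (m : ℝ) ^ Q ≤ (x ^ 2) ^ Q := by gcongr
      _ = lam ^ (1 / 2 : ℝ) := by
        rw [hx, ← Real.rpow_natCast, ← Real.rpow_natCast, ← Real.rpow_mul (by positivity),
          ← Real.rpow_mul (by positivity)]
        congr 1
        rw [hδ]
        push_cast
        field_simp
        norm_num
  let ρ : ℕ → ℕ := fun j => m ^ L ^ j
  have hρm : ∀ j, m ≤ ρ j := fun j => Nat.le_self_pow (by positivity) m
  have hρmono : Monotone ρ := fun i j hij =>
    Nat.pow_le_pow_right hm1 (Nat.pow_le_pow_right hL1 hij)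
  let V : ℕ → Submodule ℝ (EuclideanSpace ℝ (Fin d)) := fun j =>
    Submodule.span ℝ (shortDifferences (sphereLattice d lam) ξ₀ (ρ j))
  have hVmono : Monotone V := by
    intro i j hij
    refine Submodule.span_mono ?_
    rintro v ⟨ξ, hξ, rfl, h⟩
    exact ⟨ξ, hξ, rfl, h.trans (by exact_mod_cast hρmono hij)⟩
  -- At a stationary scale, the points between the radii `ρ j` and `ρ (j + 1)` add no new direction.
  obtain ⟨j, hjd, hj⟩ := exists_submodule_eq_succ hVmono
  set D : ℕ := ρ j ^ a with hD
  have hρ1 : 1 ≤ ρ j := hm1.trans (hρm j)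
  have hρsucc : ρ (j + 1) = D ^ (K + 1) := by
    simp only [ρ, hD]
    rw [← pow_mul, ← pow_mul]
    congr 1
  have hDm : m ≤ D := (hρm j).trans (Nat.le_self_pow (by omega) _)
  have hDQ : (D : ℝ) ≤ lam ^ (1 / 2 : ℝ) := by
    refine le_trans ?_ hmQ
    have h1 : D ≤ m ^ Q := by
      rw [hD, ← pow_mul]
      refine Nat.pow_le_pow_right hm1 ?_
      rw [hQ, mul_comm]
      exact Nat.mul_le_mul_left _ (Nat.pow_le_pow_right hL1 hjd)
    exact_mod_cast h1
  have h2B : 2 * (d * d.factorial * (ρ j : ℝ) ^ (2 * d + 1)) ≤ D := by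
    have h1 : 2 * (d * d.factorial) ≤ ρ j := by
      have := hρm j
      omega
    have h2 : 2 * (d * d.factorial * ρ j ^ (2 * d + 1)) ≤ D := by
      calc 2 * (d * d.factorial * ρ j ^ (2 * d + 1))
          = 2 * (d * d.factorial) * ρ j ^ (2 * d + 1) := by ring
        _ ≤ ρ j * ρ j ^ (2 * d + 1) := Nat.mul_le_mul_right _ h1
        _ = D := by rw [hD, ha]; ring
    exact_mod_cast h2
  have hD1 : 1 ≤ D := hm1.trans hDm
  have hsqrt : lam ^ (1 / 2 : ℝ) ≤ lam := by
    conv_rhs => rw [← Real.rpow_one lam]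
    exact Real.rpow_le_rpow_of_exponent_le hlam1 (by norm_num)
  have hDR : (1 : ℝ) ≤ D := by exact_mod_cast hD1
  obtain ⟨ω, hω1, hωd, hω⟩ := exists_pole_of_span_eq (R := ρ j) (R' := ρ (j + 1)) (lam := lam)
    (by exact_mod_cast hρ1) hξ₀ hj
    (h2B.trans (by
      rw [hρsucc]
      push_cast
      exact le_self_pow₀ hDR (by omega)))
    (by linarith)
  refine ⟨D, ω, hmx.trans (by exact_mod_cast hDm), hω1, hωd.trans ?_, fun ξ hξ => ?_⟩
  · rw [div_le_iff₀ hlam0]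
    refine h2B.trans (hDQ.trans_eq ?_)
    conv_rhs => rw [← Real.rpow_add_one hlam0.ne']
    norm_num
  · rcases hω ξ hξ with ⟨h1, h2⟩ | ⟨h1, h2⟩
    · refine Or.inl ⟨h1, fun i => ?_⟩
      exact (abs_le_norm_latticeVec (ξ - ξ₀) i).trans (h2.trans h2B)
    · refine Or.inr ⟨h1, ?_⟩
      have hdD : (d : ℝ) ≤ D := by exact_mod_cast (by omega : d ≤ D)
      refine exists_coord_ge (ξ := ξ - ξ₀) (by positivity) (lt_of_le_of_lt ?_ h2)
      rw [hρsucc]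
      push_cast
      rw [pow_succ, mul_comm]
      gcongr

end LatticeClusters

/-! ### Contour shift against a polynomial bump -/

section ContourShift

open Filter Topology

open MeasureTheory

/-- The segment is moved up to height `β = α / 5`. On the top side the bump factor is at most `3 ^
T`, while `f` is at most `exp(-6 T) ≤ 6 ^ (-T)`. On the vertical sides `f` is at most 1, while the
zeros of the bump at `±α` make it at most `(11 / 25) ^ T`. Each side thus carries `(1 / 2) ^ T`, and
the total length is below `3 α`. The bump is a polynomial precisely so that it can be continued off
the real axis. -/
theorem norm_integral_bump_mul_le_of_nonneg {f : ℂ → ℂ} {α μ : ℝ} {T : ℕ} (hα : 0 < α)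
    (hμ : 0 ≤ μ)
    (hf : DifferentiableOn ℂ f ((Set.uIcc (-α) α) ×ℂ (Set.uIcc (-(α / 5)) (α / 5))))
    (hb : ∀ z ∈ (Set.uIcc (-α) α) ×ℂ (Set.uIcc (-(α / 5)) (α / 5)),
      ‖f z‖ ≤ Real.exp (-(2 * Real.pi * (μ * z.im))))
    (hT : T ≤ μ * (α / 5)) :
    ‖∫ t in (-α)..α, ((1 - (t / α) ^ 2) ^ T : ℂ) * f t‖ ≤ 3 * α * (1 / 2) ^ T := by
  set β := α / 5 with hβ
  have hβ0 : 0 < β := by positivity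
  let G : ℂ → ℂ := fun z => (1 - (z / α) ^ 2) ^ T * f z
  have hu1 : Set.uIcc (-α) α = Set.Icc (-α) α := Set.uIcc_of_le (by linarith)
  have hu2 : Set.uIcc (-β) β = Set.Icc (-β) β := Set.uIcc_of_le (by linarith)
  have hsub : (Set.uIcc (-α) α) ×ℂ (Set.uIcc 0 β) ⊆ (Set.uIcc (-α) α) ×ℂ (Set.uIcc (-β) β) := by
    intro z hz
    rw [Complex.mem_reProdIm] at hz ⊢
    rw [Set.uIcc_of_le hβ0.le] at hz
    rw [hu2]
    exact ⟨hz.1, by linarith [hz.2.1], hz.2.2⟩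
  have hG : DifferentiableOn ℂ G ((Set.uIcc (-α) α) ×ℂ (Set.uIcc 0 β)) := by
    refine DifferentiableOn.mul ?_ (hf.mono hsub)
    fun_prop
  have hrect := Complex.integral_boundary_rect_eq_zero_of_differentiableOn G (-α : ℂ)
    (α + β * Complex.I) (by simpa using hG)
  simp only [Complex.neg_re, Complex.ofReal_re, Complex.neg_im, Complex.ofReal_im, neg_zero,
    Complex.add_re, Complex.mul_re, Complex.I_re, mul_zero, Complex.I_im, mul_one, sub_self,
    add_zero, Complex.add_im, Complex.mul_im, zero_add, zero_mul, smul_eq_mul,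
    Complex.ofReal_zero] at hrect
  have htop : ‖∫ x in (-α)..α, G (x + β * Complex.I)‖ ≤ (1 / 2) ^ T * |α - -α| := by
    refine intervalIntegral.norm_integral_le_of_norm_le_const fun x hx => ?_
    rw [Set.uIoc_of_le (by linarith)] at hx
    have hmem : (x + β * Complex.I : ℂ) ∈ (Set.uIcc (-α) α) ×ℂ (Set.uIcc (-β) β) := by
      rw [Complex.mem_reProdIm, hu1, hu2]
      simp
      exact ⟨⟨hx.1.le, hx.2⟩, hβ0.le⟩
    have h1 := hb _ hmem
    have him : (x + β * Complex.I : ℂ).im = β := by simp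
    rw [him] at h1
    have hn : ‖(x + β * Complex.I : ℂ)‖ ≤ 6 / 5 * α := by
      refine (norm_add_le _ _).trans ?_
      rw [norm_mul, Complex.norm_I, Complex.norm_real, Complex.norm_real, Real.norm_eq_abs,
        Real.norm_eq_abs, abs_of_pos hβ0]
      have : |x| ≤ α := abs_le.2 ⟨hx.1.le, hx.2⟩
      linarith
    have h2 : ‖(1 - ((x + β * Complex.I) / α) ^ 2 : ℂ)‖ ≤ 3 := by
      refine (norm_sub_le _ _).trans ?_
      rw [norm_one, norm_pow, norm_div, Complex.norm_real, Real.norm_of_nonneg hα.le]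
      have h3 : ‖(x + β * Complex.I : ℂ)‖ / α ≤ 6 / 5 := by
        rw [div_le_iff₀ hα]; exact hn
      have h4 : 0 ≤ ‖(x + β * Complex.I : ℂ)‖ / α := by positivity
      nlinarith
    have h3 : Real.exp (-(2 * Real.pi * (μ * β))) ≤ (1 / 6) ^ T := by
      have h4 : Real.exp (-6) ≤ 1 / 6 := by
        rw [Real.exp_neg, one_div]
        refine inv_anti₀ (by norm_num) ?_
        linarith [Real.add_one_le_exp (6 : ℝ)]
      calc Real.exp (-(2 * Real.pi * (μ * β))) ≤ Real.exp (T * (-6)) := by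
            refine Real.exp_le_exp.2 ?_
            have := Real.pi_gt_three
            have h5 : (0 : ℝ) ≤ T := by positivity
            nlinarith
        _ = Real.exp (-6) ^ T := by rw [Real.exp_nat_mul]
        _ ≤ _ := by gcongr
    calc ‖G (x + β * Complex.I)‖
        = ‖(1 - ((x + β * Complex.I) / α) ^ 2 : ℂ)‖ ^ T * ‖f (x + β * Complex.I)‖ := by
          simp only [G, norm_mul, norm_pow]
      _ ≤ 3 ^ T * (1 / 6) ^ T := by
          gcongr
          exact h1.trans h3
      _ = (1 / 2) ^ T := by rw [← mul_pow]; norm_num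
  have hside : ∀ s : ℝ, s = α ∨ s = -α →
      ‖∫ y in (0 : ℝ)..β, G (s + y * Complex.I)‖ ≤ (1 / 2) ^ T * |β - 0| := by
    intro s hs
    refine intervalIntegral.norm_integral_le_of_norm_le_const fun y hy => ?_
    rw [Set.uIoc_of_le hβ0.le] at hy
    have hmem : (s + y * Complex.I : ℂ) ∈ (Set.uIcc (-α) α) ×ℂ (Set.uIcc (-β) β) := by
      rw [Complex.mem_reProdIm, hu1, hu2]
      simp only [Complex.add_re, Complex.ofReal_re, Complex.mul_re, Complex.I_re, mul_zero,
        Complex.ofReal_im, Complex.I_im, mul_one, sub_self, add_zero, Complex.add_im,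
        Complex.mul_im, zero_add, Set.mem_Icc]
      refine ⟨?_, by linarith [hy.1], hy.2⟩
      rcases hs with rfl | rfl
      · exact ⟨by linarith, le_rfl⟩
      · exact ⟨le_rfl, by linarith⟩
    have h1 := hb _ hmem
    have him : (s + y * Complex.I : ℂ).im = y := by simp
    rw [him] at h1
    have h2 : ‖f (s + y * Complex.I)‖ ≤ 1 := by
      refine h1.trans ?_
      rw [Real.exp_le_one_iff]
      have := hy.1.le
      have := Real.pi_pos
      have : 0 ≤ 2 * Real.pi * (μ * y) := by positivity
      linarith
    have h3 : ‖(1 - ((s + y * Complex.I) / α) ^ 2 : ℂ)‖ ≤ 1 / 2 := by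
      have hαC : (α : ℂ) ≠ 0 := by exact_mod_cast hα.ne'
      have hs2 : (s : ℂ) ^ 2 = α ^ 2 := by
        rcases hs with rfl | rfl <;> push_cast <;> ring
      have h4 : (1 - ((s + y * Complex.I) / α) ^ 2 : ℂ) =
          (y / α) * ((y - 2 * s * Complex.I) / α) := by
        field_simp
        linear_combination -hs2 - y ^ 2 * Complex.I_sq
      have hsn : |s| = α := by
        rcases hs with rfl | rfl
        · exact abs_of_pos hα
        · rw [abs_neg]; exact abs_of_pos hα
      have h5 : ‖(y - 2 * s * Complex.I : ℂ)‖ ≤ y + 2 * α := by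
        refine (norm_sub_le _ _).trans ?_
        simp [hsn, abs_of_pos hy.1]
      rw [h4, norm_mul, norm_div, norm_div, Complex.norm_real, Complex.norm_real,
        Real.norm_of_nonneg hα.le, Real.norm_of_nonneg hy.1.le]
      have h6 : y / α ≤ 1 / 5 := by
        rw [div_le_iff₀ hα]; linarith [hy.2]
      have h7 : ‖(y - 2 * s * Complex.I : ℂ)‖ / α ≤ 11 / 5 := by
        rw [div_le_iff₀ hα]; linarith [hy.2]
      have h8 : 0 ≤ y / α := div_nonneg hy.1.le hα.le
      calc _ ≤ (1 / 5 : ℝ) * (11 / 5) := mul_le_mul h6 h7 (by positivity) (by norm_num)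
        _ ≤ 1 / 2 := by norm_num
    calc ‖G (s + y * Complex.I)‖
        = ‖(1 - ((s + y * Complex.I) / α) ^ 2 : ℂ)‖ ^ T * ‖f (s + y * Complex.I)‖ := by
          simp only [G, norm_mul, norm_pow]
      _ ≤ (1 / 2) ^ T * 1 := by gcongr
      _ = (1 / 2) ^ T := mul_one _
  have hr := hside α (Or.inl rfl)
  have hl := hside (-α) (Or.inr rfl)
  have hmain : (∫ t in (-α)..α, ((1 - (t / α) ^ 2) ^ T : ℂ) * f t) =
      (∫ x in (-α)..α, G (x + β * Complex.I)) -
        Complex.I * (∫ y in (0 : ℝ)..β, G (α + y * Complex.I)) +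
        Complex.I * (∫ y in (0 : ℝ)..β, G ((-α : ℝ) + y * Complex.I)) := by
    have h1 : (∫ t in (-α)..α, ((1 - (t / α) ^ 2) ^ T : ℂ) * f t) = ∫ x in (-α)..α, G (x + 0) := by
      simp [G]
    rw [h1]
    simp only [add_zero] at hrect ⊢
    linear_combination hrect
  rw [hmain]
  rw [show |α - -α| = 2 * α by rw [sub_neg_eq_add, abs_of_pos (by linarith)]; ring] at htop
  rw [sub_zero, abs_of_pos hβ0] at hr hl
  refine (norm_add_le _ _).trans ?_
  refine (add_le_add_left (norm_sub_le _ _) _).trans ?_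
  rw [norm_mul, norm_mul, Complex.norm_I, one_mul, one_mul]
  have : (0 : ℝ) < (1 / 2) ^ T := by positivity
  calc _ ≤ (1 / 2) ^ T * (2 * α) + (1 / 2) ^ T * β + (1 / 2) ^ T * β := by gcongr
    _ ≤ 3 * α * (1 / 2) ^ T := by rw [hβ]; nlinarith

/-- Averaging a holomorphic function with `|f(z)| ≤ exp(-2π μ Im z)` against a polynomial bump:
shifting the contour gains an exponential factor. -/
theorem norm_integral_bump_mul_le {f : ℂ → ℂ} {α μ : ℝ} {T : ℕ} (hα : 0 < α)
    (hf : DifferentiableOn ℂ f ((Set.uIcc (-α) α) ×ℂ (Set.uIcc (-(α / 5)) (α / 5))))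
    (hb : ∀ z ∈ (Set.uIcc (-α) α) ×ℂ (Set.uIcc (-(α / 5)) (α / 5)),
      ‖f z‖ ≤ Real.exp (-(2 * Real.pi * (μ * z.im))))
    (hT : T ≤ |μ| * (α / 5)) :
    ‖∫ t in (-α)..α, ((1 - (t / α) ^ 2) ^ T : ℂ) * f t‖ ≤ 3 * α * (1 / 2) ^ T := by
  rcases le_or_gt 0 μ with hμ | hμ
  · rw [abs_of_nonneg hμ] at hT
    exact norm_integral_bump_mul_le_of_nonneg hα hμ hf hb hT
  · rw [abs_of_neg hμ] at hT
    -- For negative `μ` the contour goes down; the symmetry of the rectangle under `z ↦ -z` reduces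
    -- this to the first case.
    have hneg : ∀ z ∈ (Set.uIcc (-α) α) ×ℂ (Set.uIcc (-(α / 5)) (α / 5)),
        -z ∈ (Set.uIcc (-α) α) ×ℂ (Set.uIcc (-(α / 5)) (α / 5)) := by
      intro z hz
      rw [Complex.mem_reProdIm, Set.uIcc_of_le (by linarith), Set.uIcc_of_le (by linarith)] at hz ⊢
      simp only [Complex.neg_re, Complex.neg_im, Set.mem_Icc] at hz ⊢
      obtain ⟨⟨h1, h2⟩, h3, h4⟩ := hz
      refine ⟨⟨?_, ?_⟩, ?_, ?_⟩ <;> linarith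
    have h := norm_integral_bump_mul_le_of_nonneg (f := fun z => f (-z)) (μ := -μ) (T := T) hα
      (by linarith) (hf.comp (differentiableOn_neg _) hneg) (fun z hz => by
        have := hb _ (hneg z hz)
        rw [Complex.neg_im] at this
        convert this using 4
        ring) hT
    have h2 := intervalIntegral.integral_comp_neg (a := -α) (b := α)
      (fun t : ℝ => ((1 - (t / α) ^ 2) ^ T : ℂ) * f t)
    rw [neg_neg] at h2
    rw [← h2]
    refine le_trans (le_of_eq ?_) h
    congr 1
    refine intervalIntegral.integral_congr fun t _ => ?_
    push_cast
    rw [neg_div, neg_sq]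

end ContourShift

/-! ### Bump averages over cubes -/

section BumpAverage

open Filter Topology

open MeasureTheory

/-- The cube `[-α, α]^d`. -/
def cube (d : ℕ) (α : ℝ) : Set (Fin d → ℝ) := Set.univ.pi fun _ => Set.Icc (-α) α

/-- A polynomial bump on the cube `[-α, α]^d`. -/
noncomputable def bump {d : ℕ} (α : ℝ) (T : ℕ) (t : Fin d → ℝ) : ℝ := ∏ i, (1 - (t i / α) ^ 2) ^ T

theorem isCompact_cube (d : ℕ) (α : ℝ) : IsCompact (cube d α) :=
  isCompact_univ_pi fun _ => isCompact_Icc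

theorem volume_restrict_cube (d : ℕ) (α : ℝ) : (volume : Measure (Fin d → ℝ)).restrict (cube d α) =
    Measure.pi fun _ => (volume : Measure ℝ).restrict (Set.Icc (-α) α) := by
  rw [volume_pi, cube, Measure.restrict_pi_pi]

theorem one_sub_div_sq_mem {α x : ℝ} (hx : x ∈ Set.Icc (-α) α) :
    0 ≤ 1 - (x / α) ^ 2 ∧ 1 - (x / α) ^ 2 ≤ 1 := by
  have h1 : |x / α| ≤ 1 := by
    rw [abs_div]
    exact div_le_one_of_le₀ ((abs_le.2 hx).trans (le_abs_self α)) (abs_nonneg _)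
  have h2 : (x / α) ^ 2 ≤ 1 := (sq_le_one_iff_abs_le_one _).2 h1
  exact ⟨by linarith, by linarith [sq_nonneg (x / α)]⟩

theorem continuous_bump {d : ℕ} (α : ℝ) (T : ℕ) : Continuous (bump (d := d) α T) := by
  unfold bump
  fun_prop

/-- On `[0, α]` the bump factor dominates `(1 - x / α) ^ T`, whose integral is `α / (T + 1)`. The
mass of the bump is therefore only polynomially small in `T`. -/
theorem le_integral_bump {α : ℝ} (hα : 0 < α) (T d : ℕ) :
    (α / (T + 1)) ^ d ≤ ∫ t in cube d α, bump α T t := by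
  have h1 : ∫ t in cube d α, bump α T t =
      ∏ _i : Fin d, ∫ x in Set.Icc (-α) α, (1 - (x / α) ^ 2) ^ T := by
    rw [volume_restrict_cube]
    exact integral_fintype_prod_eq_prod (𝕜 := ℝ) (fun (_ : Fin d) (x : ℝ) => (1 - (x / α) ^ 2) ^ T)
  rw [h1, Finset.prod_const, Finset.card_univ, Fintype.card_fin]
  refine pow_le_pow_left₀ (by positivity) ?_ _
  have hint : IntegrableOn (fun x : ℝ => (1 - (x / α) ^ 2) ^ T) (Set.Icc (-α) α) :=
    (by fun_prop : Continuous fun x : ℝ => (1 - (x / α) ^ 2) ^ T).continuousOn.integrableOn_compact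
      isCompact_Icc
  have hint2 : IntegrableOn (fun x : ℝ => (1 - x / α) ^ T) (Set.Icc 0 α) :=
    (by fun_prop : Continuous fun x : ℝ => (1 - x / α) ^ T).continuousOn.integrableOn_compact
      isCompact_Icc
  calc α / (T + 1) = ∫ x in (0 : ℝ)..α, (1 - x / α) ^ T := by
        have := intervalIntegral.integral_comp_sub_div (a := 0) (b := α)
          (fun x : ℝ => x ^ T) hα.ne' 1
        rw [this]
        simp [hα.ne', integral_pow]
        ring
    _ = ∫ x in Set.Icc 0 α, (1 - x / α) ^ T := by
        rw [intervalIntegral.integral_of_le hα.le, integral_Icc_eq_integral_Ioc]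
    _ ≤ ∫ x in Set.Icc 0 α, (1 - (x / α) ^ 2) ^ T := by
        refine setIntegral_mono_on hint2 (hint.mono_set (Set.Icc_subset_Icc_left (by linarith)))
          measurableSet_Icc fun x hx => ?_
        have h2 : 0 ≤ x / α := div_nonneg hx.1 hα.le
        have h3 : x / α ≤ 1 := div_le_one_of_le₀ hx.2 hα.le
        refine pow_le_pow_left₀ (by linarith) ?_ _
        nlinarith
    _ ≤ ∫ x in Set.Icc (-α) α, (1 - (x / α) ^ 2) ^ T := by
        refine setIntegral_mono_set hint ?_
          (Set.Icc_subset_Icc_left (by linarith)).eventuallyLE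
        filter_upwards [ae_restrict_mem measurableSet_Icc] with x hx
        exact pow_nonneg (one_sub_div_sq_mem hx).1 _

/-- The bump average over a cube of a holomorphic function decaying exponentially in one
imaginary coordinate direction. -/
theorem norm_setIntegral_cube_bump_mul_le {d : ℕ} {f : (Fin d → ℂ) → ℂ} {α μ r : ℝ} {T : ℕ}
    (hα : 0 < α) (hα3 : α ≤ 1 / 3) (hr : 2 * α ≤ r) (j : Fin d)
    (hf : DifferentiableOn ℂ f (Metric.ball 0 r))
    (hb : ∀ z ∈ Metric.ball (0 : Fin d → ℂ) r, (∀ i, i ≠ j → (z i).im = 0) →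
      ‖f z‖ ≤ Real.exp (-(2 * Real.pi * (μ * (z j).im))))
    (hT : T ≤ |μ| * (α / 5)) :
    ‖∫ t in cube d α, (bump α T t : ℂ) * f fun i => (t i : ℂ)‖ ≤ (1 / 2) ^ T := by
  obtain ⟨n, rfl⟩ : ∃ n, d = n + 1 := ⟨d - 1, by have := j.pos; omega⟩
  let F : (Fin (n + 1) → ℝ) → ℂ := fun t => (bump α T t : ℂ) * f fun i => (t i : ℂ)
  have hcont : ContinuousOn F (cube (n + 1) α) := by
    refine ContinuousOn.mul ?_ ?_
    · exact (Complex.continuous_ofReal.comp (continuous_bump α T)).continuousOn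
    · refine hf.continuousOn.comp (by fun_prop) fun t ht => ?_
      rw [mem_ball_zero_iff, pi_norm_lt_iff (by linarith)]
      intro i
      rw [Complex.norm_real, Real.norm_eq_abs]
      have := abs_le.2 (ht i (Set.mem_univ i))
      linarith
  have hint : Integrable F (Measure.pi fun _ => (volume : Measure ℝ).restrict (Set.Icc (-α) α)) := by
    rw [← volume_restrict_cube]
    exact hcont.integrableOn_compact (isCompact_cube _ _)
  set ν : Measure ℝ := (volume : Measure ℝ).restrict (Set.Icc (-α) α) with hν
  have hmp := measurePreserving_piFinSuccAbove (fun _ : Fin (n + 1) => ν) j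
  set e := MeasurableEquiv.piFinSuccAbove (fun _ : Fin (n + 1) => ℝ) j with he
  have hesymm : ∀ x : ℝ × (Fin n → ℝ), e.symm x = j.insertNth x.1 x.2 := fun x => rfl
  have hint2 : Integrable (fun x => F (e.symm x)) (ν.prod (Measure.pi fun _ : Fin n => ν)) :=
    (hmp.symm.integrable_comp_emb e.symm.measurableEmbedding).2 hint
  -- Fubini with the `j`-th variable innermost, since the contour is shifted in this variable only.
  have h1 : ∫ t in cube (n + 1) α, F t =
      ∫ y, ∫ x, F (j.insertNth x y) ∂ν ∂(Measure.pi fun _ : Fin n => ν) := by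
    rw [volume_restrict_cube, ← hmp.symm.integral_comp' F]
    exact integral_prod_symm _ hint2
  change ‖∫ t in cube (n + 1) α, F t‖ ≤ _
  rw [h1]
  -- The assumption `α ≤ 1 / 3` makes the side length `2 α` at most 1; below it also absorbs the
  -- factor `3 α`.
  have hvol : (Measure.pi fun _ : Fin n => ν).real Set.univ ≤ 1 := by
    have h2 : (Measure.pi fun _ : Fin n => ν) Set.univ = ENNReal.ofReal (2 * α) ^ n := by
      rw [Measure.pi_univ]
      simp only [hν, Measure.restrict_apply_univ, Real.volume_Icc, Finset.prod_const,
        Finset.card_univ, Fintype.card_fin]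
      congr 2
      ring
    rw [Measure.real, h2, ENNReal.toReal_pow, ENNReal.toReal_ofReal (by linarith)]
    exact pow_le_one₀ (by linarith) (by linarith)
  have haebox : ∀ᵐ y ∂(Measure.pi fun _ : Fin n => ν), y ∈ cube n α := by
    rw [hν, ← volume_restrict_cube]
    exact ae_restrict_mem (isCompact_cube n α).measurableSet
  have hinner : ∀ᵐ y ∂(Measure.pi fun _ : Fin n => ν),
      ‖∫ x, F (j.insertNth x y) ∂ν‖ ≤ 3 * α * (1 / 2) ^ T := by
    filter_upwards [haebox] with y hy
    -- Only coordinate `j` becomes complex, as the decay hypothesis requires. On the rectangle `|Re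
    -- z| + |Im z| ≤ 6 α / 5 < r`.
    let γ : ℂ → Fin (n + 1) → ℂ := fun z => j.insertNth z fun i => (y i : ℂ)
    have hγj : ∀ z, γ z j = z := fun z => by simp [γ]
    have hγi : ∀ z i, γ z (j.succAbove i) = y i := fun z i => by simp [γ]
    have hγr : ∀ x : ℝ, γ x = fun i => ((j.insertNth x y : Fin (n + 1) → ℝ) i : ℂ) := by
      intro x
      funext i
      refine Fin.succAboveCases j ?_ (fun i => ?_) i
      · simp [γ]
      · simp [γ]
    have hγd : Differentiable ℂ γ := by
      rw [differentiable_pi]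
      intro i
      refine Fin.succAboveCases j ?_ (fun i => ?_) i
      · simp only [hγj]; exact differentiable_id
      · simp only [hγi]; exact differentiable_const _
    have hyα : ∀ i, |y i| ≤ α := fun i => abs_le.2 (hy i (Set.mem_univ i))
    have hγball : ∀ z ∈ (Set.uIcc (-α) α) ×ℂ (Set.uIcc (-(α / 5)) (α / 5)), γ z ∈ Metric.ball 0 r := by
      intro z hz
      rw [Complex.mem_reProdIm, Set.uIcc_of_le (by linarith), Set.uIcc_of_le (by linarith)] at hz
      rw [mem_ball_zero_iff, pi_norm_lt_iff (by linarith)]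
      intro i
      refine Fin.succAboveCases j ?_ (fun i => ?_) i
      · rw [hγj]
        have h2 := Complex.norm_le_abs_re_add_abs_im z
        have h3 := abs_le.2 hz.1
        have h4 := abs_le.2 hz.2
        linarith
      · rw [hγi, Complex.norm_real, Real.norm_eq_abs]
        linarith [hyα i]
    have hmain := norm_integral_bump_mul_le (f := fun z => f (γ z)) (μ := μ) (T := T) hα
      (hf.comp hγd.differentiableOn hγball) (fun z hz => by
        have := hb _ (hγball z hz) (fun i => by
          refine Fin.succAboveCases j ?_ (fun i => ?_) i
          · intro h; exact absurd rfl h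
          · intro _; rw [hγi, Complex.ofReal_im])
        rwa [hγj] at this) hT
    have hF : ∀ x : ℝ, F (j.insertNth x y) =
        ((∏ i, (1 - (y i / α) ^ 2) ^ T : ℝ) : ℂ) * (((1 - (x / α) ^ 2) ^ T : ℂ) * f (γ x)) := by
      intro x
      have h2 : bump α T (j.insertNth x y : Fin (n + 1) → ℝ) =
          (1 - (x / α) ^ 2) ^ T * ∏ i, (1 - (y i / α) ^ 2) ^ T := by
        rw [bump, Fin.prod_univ_succAbove _ j]
        simp
      simp only [F]
      rw [h2, hγr]
      push_cast
      ring
    have h3 : ‖((∏ i, (1 - (y i / α) ^ 2) ^ T : ℝ) : ℂ)‖ ≤ 1 := by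
      rw [Complex.norm_real, Real.norm_eq_abs, Finset.abs_prod]
      refine Finset.prod_le_one (fun _ _ => abs_nonneg _) fun i _ => ?_
      have h4 := one_sub_div_sq_mem (hy i (Set.mem_univ i))
      rw [abs_pow, abs_of_nonneg h4.1]
      exact pow_le_one₀ h4.1 h4.2
    simp_rw [hF]
    rw [integral_const_mul, norm_mul]
    refine (mul_le_of_le_one_left (norm_nonneg _) h3).trans ?_
    rw [hν, integral_Icc_eq_integral_Ioc, ← intervalIntegral.integral_of_le (by linarith)]
    exact hmain
  refine (norm_integral_le_of_norm_le_const hinner).trans ?_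
  have h5 : 3 * α * (1 / 2) ^ T ≤ (1 / 2) ^ T := by
    have : (0 : ℝ) < (1 / 2) ^ T := by positivity
    nlinarith
  exact (mul_le_mul h5 hvol measureReal_nonneg (by positivity)).trans_eq (mul_one _)

end BumpAverage

/-! ### Extraction of a single coefficient -/

section Extraction

open Filter Topology

variable {d : ℕ}

/-- The exponential `exp(2πi w)`. -/
noncomputable def expTwoPiI (w : ℂ) : ℂ := Complex.exp (2 * Real.pi * Complex.I * w)

theorem expTwoPiI_add (w w' : ℂ) : expTwoPiI (w + w') = expTwoPiI w * expTwoPiI w' := by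
  simp only [expTwoPiI, mul_add, Complex.exp_add]

theorem expTwoPiI_zero : expTwoPiI 0 = 1 := by simp [expTwoPiI]

theorem norm_expTwoPiI (w : ℂ) : ‖expTwoPiI w‖ = Real.exp (-(2 * Real.pi * w.im)) := by
  rw [expTwoPiI, Complex.norm_exp]
  congr 1
  simp

theorem norm_expTwoPiI_ofReal (x : ℝ) : ‖expTwoPiI x‖ = 1 := by
  simp [norm_expTwoPiI]

theorem differentiable_expTwoPiI : Differentiable ℂ expTwoPiI := by
  unfold expTwoPiI
  fun_prop

/-- `|1 - e(x)| = 2 sin(πx)`, and Jordan's inequality gives `sin(πx) ≥ 2x` on this range. -/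
theorem le_norm_one_sub_expTwoPiI {x : ℝ} (h0 : 0 ≤ x) (h1 : x ≤ 1 / 2) :
    4 * x ≤ ‖1 - expTwoPiI x‖ := by
  have h2 : expTwoPiI x = Complex.exp (Complex.I * ((2 * Real.pi * x : ℝ) : ℂ)) := by
    rw [expTwoPiI]
    congr 1
    push_cast
    ring
  have hpi := Real.pi_pos
  rw [h2, norm_sub_rev, Complex.norm_exp_I_mul_ofReal_sub_one, Real.norm_eq_abs]
  have h3 := Real.mul_le_sin (x := 2 * Real.pi * x / 2) (by positivity) (by nlinarith)
  have h4 : 2 / Real.pi * (2 * Real.pi * x / 2) = 2 * x := by field_simp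
  rw [h4] at h3
  exact le_trans (by linarith) (le_abs_self _)

/-- The constant coefficient of an exponential sum with integer frequencies of size at most `D` is
controlled by its size on a ball: the other frequencies are removed by finite differences. -/
theorem norm_coeff_le_of_exp_sum_le {h D : ℝ} (hh : 0 < h) (hhD : h * (d * D ^ 2) ≤ 1 / 2)
    {y₀ : EuclideanSpace ℝ (Fin d)} (N : Finset (Fin d → ℤ)) (h0N : (0 : Fin d → ℤ) ∉ N)
    (hN : ∀ ξ ∈ N, ∀ i, |(ξ i : ℝ)| ≤ D) (b : (Fin d → ℤ) → ℂ) (b₀ : ℂ) (ε ρ : ℝ)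
    (hρ : N.card * (h * D) ≤ ρ)
    (hε : ∀ y, ‖toComplex (y - y₀)‖ ≤ ρ →
      ‖b₀ + ∑ ξ ∈ N, b ξ * expTwoPiI ((inner ℝ (latticeVec ξ) y : ℝ) : ℂ)‖ ≤ ε) :
    ‖b₀‖ * (2 * h) ^ N.card ≤ ε := by
  classical
  induction N using Finset.induction_on generalizing b b₀ ε ρ with
  | empty =>
    have hρ0 : 0 ≤ ρ := by simpa using hρ
    have h0 : toComplex (0 : EuclideanSpace ℝ (Fin d)) = 0 := by ext i; simp [toComplex]
    have := hε y₀ (by rw [sub_self, h0, norm_zero]; exact hρ0)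
    simpa using this
  | insert η N hη ih =>
    rw [Finset.card_insert_of_notMem hη] at hρ ⊢
    push_cast at hρ
    set v := latticeVec η with hv
    have hηD := hN η (Finset.mem_insert_self _ _)
    have hη0 : η ≠ 0 := fun h => h0N (h ▸ Finset.mem_insert_self _ _)
    have hv1 : 1 ≤ ‖v‖ ^ 2 := by
      rw [norm_latticeVec_sq]
      have h1 : (1 : ℤ) ≤ ∑ i, η i ^ 2 := by
        obtain ⟨i, hi⟩ := Function.ne_iff.1 hη0
        have h2 : 0 < η i ^ 2 := sq_pos_of_ne_zero hi
        have h3 : η i ^ 2 ≤ ∑ i, η i ^ 2 :=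
          Finset.single_le_sum (f := fun i => η i ^ 2) (fun i _ => sq_nonneg _) (Finset.mem_univ i)
        omega
      exact_mod_cast h1
    have hv2 : ‖v‖ ^ 2 ≤ d * D ^ 2 := by
      rw [norm_latticeVec_sq]
      calc ∑ i, (η i : ℝ) ^ 2 ≤ ∑ _i : Fin d, D ^ 2 :=
            Finset.sum_le_sum fun i _ => by rw [← sq_abs]; gcongr; exact hηD i
        _ = d * D ^ 2 := by simp
    have hvC : ‖toComplex v‖ ≤ D := by
      have hD : 0 ≤ D := by
        obtain ⟨i, _⟩ := Function.ne_iff.1 hη0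
        exact (abs_nonneg _).trans (hηD i)
      refine (pi_norm_le_iff_of_nonneg hD).2 fun i => ?_
      simpa [toComplex, hv, latticeVec] using hηD i
    -- Translation by `h • v` multiplies the exponential of frequency `η` by `κ`. Hence `F(y + h v)
    -- - κ F(y)` removes `η` and multiplies the constant term by `1 - κ`, of modulus at least `4 h`
    -- because `1 ≤ |η|²` and `h |η|² ≤ 1 / 2`. The sup bound doubles and the radius drops by `h D`,
    -- so each frequency costs a net factor `2 h`.
    set κ := expTwoPiI ((h * ‖v‖ ^ 2 : ℝ) : ℂ) with hκ
    have hκ1 : ‖κ‖ = 1 := norm_expTwoPiI_ofReal _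
    have hκh : 4 * h ≤ ‖1 - κ‖ := by
      refine le_trans ?_ (le_norm_one_sub_expTwoPiI (by positivity) ?_)
      · nlinarith
      · exact (mul_le_mul_of_nonneg_left hv2 hh.le).trans hhD
    have hstep := ih (fun h => h0N (Finset.mem_insert_of_mem h))
      (fun ξ hξ => hN ξ (Finset.mem_insert_of_mem hξ))
      (fun ξ => b ξ * (expTwoPiI ((inner ℝ (latticeVec ξ) (h • v) : ℝ) : ℂ) - κ))
      (b₀ * (1 - κ)) (2 * ε) (ρ - h * D) (by linarith) (by
        intro y hy
        have hyρ : ‖toComplex (y - y₀)‖ ≤ ρ := by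
          have : 0 ≤ h * D := mul_nonneg hh.le ((norm_nonneg _).trans hvC)
          linarith
        have hyρ2 : ‖toComplex (y + h • v - y₀)‖ ≤ ρ := by
          rw [add_sub_right_comm, toComplex_add, toComplex_smul]
          refine (norm_add_le _ _).trans ?_
          rw [norm_smul, Complex.norm_real, Real.norm_of_nonneg hh.le]
          have : h * ‖toComplex v‖ ≤ h * D := by gcongr
          linarith
        have h1 := hε y hyρ
        have h2 := hε _ hyρ2
        have h3 : b₀ * (1 - κ) + ∑ ξ ∈ N, b ξ * (expTwoPiI
            ((inner ℝ (latticeVec ξ) (h • v) : ℝ) : ℂ) - κ) *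
              expTwoPiI ((inner ℝ (latticeVec ξ) y : ℝ) : ℂ) =
            (b₀ + ∑ ξ ∈ insert η N, b ξ *
              expTwoPiI ((inner ℝ (latticeVec ξ) (y + h • v) : ℝ) : ℂ)) -
            κ * (b₀ + ∑ ξ ∈ insert η N, b ξ *
              expTwoPiI ((inner ℝ (latticeVec ξ) y : ℝ) : ℂ)) := by
          have hsplit : ∀ ξ, expTwoPiI ((inner ℝ (latticeVec ξ) (y + h • v) : ℝ) : ℂ) =
              expTwoPiI ((inner ℝ (latticeVec ξ) y : ℝ) : ℂ) *
                expTwoPiI ((inner ℝ (latticeVec ξ) (h • v) : ℝ) : ℂ) := by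
            intro ξ
            rw [← expTwoPiI_add, inner_add_right]
            push_cast
            rfl
          have hηκ : expTwoPiI ((inner ℝ (latticeVec η) (h • v) : ℝ) : ℂ) = κ := by
            rw [← hv, inner_smul_right, real_inner_self_eq_norm_sq]
          simp only [hsplit]
          rw [Finset.sum_insert hη, Finset.sum_insert hη, hηκ]
          have h4 : ∑ ξ ∈ N, b ξ * (expTwoPiI
              ((inner ℝ (latticeVec ξ) (h • v) : ℝ) : ℂ) - κ) *
                expTwoPiI ((inner ℝ (latticeVec ξ) y : ℝ) : ℂ) =
              (∑ ξ ∈ N, b ξ * (expTwoPiI ((inner ℝ (latticeVec ξ) y : ℝ) : ℂ) *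
                expTwoPiI ((inner ℝ (latticeVec ξ) (h • v) : ℝ) : ℂ))) -
              κ * ∑ ξ ∈ N, b ξ * expTwoPiI ((inner ℝ (latticeVec ξ) y : ℝ) : ℂ) := by
            rw [Finset.mul_sum, ← Finset.sum_sub_distrib]
            exact Finset.sum_congr rfl fun ξ _ => by ring
          rw [h4]
          ring
        rw [h3]
        refine (norm_sub_le _ _).trans ?_
        rw [norm_mul, hκ1, one_mul]
        linarith)
    rw [norm_mul] at hstep
    have hp : 0 ≤ ‖b₀‖ * (2 * h) ^ N.card := by positivity
    have h5 : ‖b₀‖ * (2 * h) ^ N.card * (4 * h) ≤ 2 * ε := by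
      refine le_trans ?_ hstep
      calc ‖b₀‖ * (2 * h) ^ N.card * (4 * h) ≤ ‖b₀‖ * (2 * h) ^ N.card * ‖1 - κ‖ := by gcongr
        _ = _ := by ring
    rw [pow_succ]
    linarith

open MeasureTheory

/-- A trigonometric polynomial vanishing at the complex points `y + W(y) ω`, whose frequencies are
either within `D` of `ξ₀` on the hyperplane `⟪ξ - ξ₀, ω⟫ = 0`, or at distance at least `R` from `ξ₀`
and below this hyperplane, has a small coefficient at `ξ₀`. -/
theorem norm_coeff_le_of_cluster {r α h D R M : ℝ} {T : ℕ} {y₀ ω : EuclideanSpace ℝ (Fin d)}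
    {W : (Fin d → ℂ) → ℂ} (hWd : DifferentiableOn ℂ W (Metric.ball (toComplex y₀) r))
    (hWim : ∀ y ∈ Metric.ball (toComplex y₀) r, (W y).im ≤ 0)
    {E : Finset (Fin d → ℤ)} {a : (Fin d → ℤ) → ℂ}
    (hvan : ∀ y ∈ Metric.ball (toComplex y₀) r,
      ∑ ξ ∈ E, a ξ * expTwoPiI (complexInner (latticeVec ξ) (y + W y • toComplex ω)) = 0)
    {ξ₀ : Fin d → ℤ} (hξ₀ : ξ₀ ∈ E)
    (hcl : ∀ ξ ∈ E,
      (inner ℝ (latticeVec (ξ - ξ₀)) ω = 0 ∧ ∀ i, |((ξ i - ξ₀ i : ℤ) : ℝ)| ≤ D) ∨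
      (inner ℝ (latticeVec (ξ - ξ₀)) ω ≤ 0 ∧ ∃ i, R ≤ |((ξ i - ξ₀ i : ℤ) : ℝ)|))
    (haM : ∀ ξ ∈ E, ‖a ξ‖ ≤ M) (hα : 0 < α) (hα3 : α ≤ 1 / 3) (hαr : 4 * α ≤ r)
    (hT : T ≤ R * (α / 5)) (hh : 0 < h) (hhD : h * (d * D ^ 2) ≤ 1 / 2) {n : ℕ}
    (hn : ∀ N ⊆ E, (∀ ξ ∈ N, ∀ i, |((ξ i - ξ₀ i : ℤ) : ℝ)| ≤ D) → N.card ≤ n)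
    (hh1 : 2 * h ≤ 1) (hhr : n * (h * D) ≤ r / 4) :
    ‖a ξ₀‖ * (α / (T + 1)) ^ d * (2 * h) ^ n ≤ E.card * M * (1 / 2) ^ T := by
  classical
  set near := E.filter fun ξ => inner ℝ (latticeVec (ξ - ξ₀)) ω = 0 ∧
    ∀ i, |((ξ i - ξ₀ i : ℤ) : ℝ)| ≤ D with hnear
  set far := E.filter fun ξ => ¬ (inner ℝ (latticeVec (ξ - ξ₀)) ω = 0 ∧
    ∀ i, |((ξ i - ξ₀ i : ℤ) : ℝ)| ≤ D) with hfar
  let Z : (Fin d → ℂ) → Fin d → ℂ := fun y => y + W y • toComplex ω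
  -- The terms of the sum after division by the exponential of `ξ₀`; the quotient still sums to
  -- zero.
  let f : (Fin d → ℤ) → (Fin d → ℂ) → ℂ := fun ξ y =>
    expTwoPiI (complexInner (latticeVec (ξ - ξ₀)) (Z y))
  have hM0 : 0 ≤ M := (norm_nonneg _).trans (haM ξ₀ hξ₀)
  have hr : 0 < r := by linarith
  have hfd : ∀ ξ, DifferentiableOn ℂ (f ξ) (Metric.ball (toComplex y₀) r) := by
    intro ξ
    refine differentiable_expTwoPiI.comp_differentiableOn ?_
    exact (complexInner _).differentiable.comp_differentiableOn
      (differentiableOn_id.add (hWd.smul_const _))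
  have hsum : ∀ y ∈ Metric.ball (toComplex y₀) r, ∑ ξ ∈ E, a ξ * f ξ y = 0 := by
    intro y hy
    have h1 : ∀ ξ, f ξ y = expTwoPiI (complexInner (latticeVec ξ) (Z y)) *
        expTwoPiI (-complexInner (latticeVec ξ₀) (Z y)) := by
      intro ξ
      rw [← expTwoPiI_add]
      simp only [f]
      congr 1
      rw [latticeVec_sub]
      simp only [complexInner_apply, PiLp.sub_apply, Complex.ofReal_sub, sub_mul,
        Finset.sum_sub_distrib]
      ring
    simp_rw [h1, ← mul_assoc]
    rw [← Finset.sum_mul, hvan y hy, zero_mul]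
  -- translated cubes stay inside the ball
  let τ : EuclideanSpace ℝ (Fin d) → (Fin d → ℂ) → Fin d → ℂ := fun y z => toComplex y + z
  have hτ : ∀ y, ‖toComplex (y - y₀)‖ ≤ r / 4 → ∀ z ∈ Metric.ball (0 : Fin d → ℂ) (r / 2),
      τ y z ∈ Metric.ball (toComplex y₀) r := by
    intro y hy z hz
    rw [mem_ball_zero_iff] at hz
    rw [Metric.mem_ball, dist_eq_norm]
    have h1 : τ y z - toComplex y₀ = toComplex (y - y₀) + z := by
      simp only [τ, toComplex_sub]; abel
    rw [h1]
    refine (norm_add_le _ _).trans_lt ?_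
    linarith
  have hcube : ∀ t ∈ cube d α, (fun i => (t i : ℂ)) ∈ Metric.ball (0 : Fin d → ℂ) (r / 2) := by
    intro t ht
    rw [mem_ball_zero_iff, pi_norm_lt_iff (by linarith)]
    intro i
    rw [Complex.norm_real, Real.norm_eq_abs]
    have := abs_le.2 (ht i (Set.mem_univ i))
    linarith
  have hτd : ∀ y, Differentiable ℂ (τ y) := fun y => (differentiable_id).const_add _
  -- The average is taken over the cube centred at a real point `y`, which stays free for the finite
  -- differences.
  let J : (Fin d → ℤ) → EuclideanSpace ℝ (Fin d) → ℂ := fun ξ y =>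
    ∫ t in cube d α, (bump α T t : ℂ) * f ξ (τ y fun i => (t i : ℂ))
  let γ : (Fin d → ℤ) → ℂ := fun ξ => ∫ t in cube d α, (bump α T t : ℂ) *
    expTwoPiI (complexInner (latticeVec (ξ - ξ₀)) fun i => (t i : ℂ))
  have hint : ∀ ξ y, ‖toComplex (y - y₀)‖ ≤ r / 4 →
      IntegrableOn (fun t => (bump α T t : ℂ) * f ξ (τ y fun i => (t i : ℂ))) (cube d α) := by
    intro ξ y hy
    refine ContinuousOn.integrableOn_compact (isCompact_cube d α) ?_
    refine ContinuousOn.mul ?_ ?_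
    · exact (Complex.continuous_ofReal.comp (continuous_bump α T)).continuousOn
    · refine (hfd ξ).continuousOn.comp ((hτd y).continuous.comp (by fun_prop)).continuousOn ?_
      intro t ht
      exact hτ y hy _ (hcube t ht)
  have hJsum : ∀ y, ‖toComplex (y - y₀)‖ ≤ r / 4 → ∑ ξ ∈ E, a ξ * J ξ y = 0 := by
    intro y hy
    have h1 : ∑ ξ ∈ E, a ξ * J ξ y = ∫ t in cube d α, ∑ ξ ∈ E,
        a ξ * ((bump α T t : ℂ) * f ξ (τ y fun i => (t i : ℂ))) := by
      rw [integral_finsetSum _ fun ξ _ => (hint ξ y hy).const_mul _]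
      exact Finset.sum_congr rfl fun ξ _ => (integral_const_mul _ _).symm
    rw [h1]
    refine setIntegral_eq_zero_of_forall_eq_zero fun t ht => ?_
    have h2 := hsum _ (hτ y hy _ (hcube t ht))
    calc _ = (bump α T t : ℂ) * ∑ ξ ∈ E, a ξ * f ξ (τ y fun i => (t i : ℂ)) := by
          rw [Finset.mul_sum]
          exact Finset.sum_congr rfl fun ξ _ => by ring
      _ = 0 := by rw [h2, mul_zero]
  -- On the hyperplane `⟪ξ - ξ₀, ω⟫ = 0` the function `W` drops out, so averaging only multiplies
  -- the exponential by the constant `γ ξ`.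
  have hJnear : ∀ ξ ∈ near, ∀ y, J ξ y =
      γ ξ * expTwoPiI ((inner ℝ (latticeVec (ξ - ξ₀)) y : ℝ) : ℂ) := by
    intro ξ hξ y
    have hω := (Finset.mem_filter.1 hξ).2.1
    simp only [J, γ]
    rw [← integral_mul_const]
    refine integral_congr_ae (Eventually.of_forall fun t => ?_)
    simp only [f, Z, τ, map_add, map_smul, complexInner_toComplex, hω, Complex.ofReal_zero,
      smul_zero, expTwoPiI_add, expTwoPiI_zero, mul_one]
    ring
  have hJfar : ∀ ξ ∈ far, ∀ y, ‖toComplex (y - y₀)‖ ≤ r / 4 → ‖J ξ y‖ ≤ (1 / 2) ^ T := by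
    intro ξ hξ y hy
    obtain ⟨hξE, hnot⟩ := Finset.mem_filter.1 hξ
    obtain ⟨hω, j, hj⟩ := (hcl ξ hξE).resolve_left hnot
    refine norm_setIntegral_cube_bump_mul_le (f := fun z => f ξ (τ y z)) (r := r / 2)
      (μ := ((ξ j - ξ₀ j : ℤ) : ℝ)) hα hα3 (by linarith) j ?_ ?_ ?_
    · exact (hfd ξ).comp (hτd y).differentiableOn (hτ y hy)
    · intro z hz hzj
      simp only [f]
      rw [norm_expTwoPiI]
      refine Real.exp_le_exp.2 (neg_le_neg ?_)
      refine mul_le_mul_of_nonneg_left ?_ (by positivity)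
      -- The first summand is real, the second has imaginary part `(ξ j - ξ₀ j) Im z_j`, and the
      -- third has nonnegative imaginary part, being a product of two nonpositive signs.
      have h1 : complexInner (latticeVec (ξ - ξ₀)) (Z (τ y z)) =
          ((inner ℝ (latticeVec (ξ - ξ₀)) y : ℝ) : ℂ) + complexInner (latticeVec (ξ - ξ₀)) z +
            W (τ y z) * ((inner ℝ (latticeVec (ξ - ξ₀)) ω : ℝ) : ℂ) := by
        simp only [Z, τ, map_add, map_smul, complexInner_toComplex, smul_eq_mul]
      have h2 : (complexInner (latticeVec (ξ - ξ₀)) z).im = ((ξ j - ξ₀ j : ℤ) : ℝ) * (z j).im := by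
        rw [complexInner_apply, Complex.im_sum, Finset.sum_eq_single j]
        · simp [latticeVec]
        · intro i _ hij
          simp [hzj i hij]
        · simp
      rw [h1, Complex.add_im, Complex.add_im, h2, Complex.ofReal_im, zero_add, Complex.im_mul_ofReal]
      have h3 := hWim _ (hτ y hy z hz)
      nlinarith
    · exact hT.trans (by gcongr)
  have hsplit : ∀ y, ∑ ξ ∈ E, a ξ * J ξ y =
      (∑ ξ ∈ near, a ξ * J ξ y) + ∑ ξ ∈ far, a ξ * J ξ y := fun y =>
    (Finset.sum_filter_add_sum_filter_not E _ _).symm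
  have hcard : (far.card : ℝ) ≤ E.card := by exact_mod_cast Finset.card_filter_le _ _
  have hbound : ∀ y, ‖toComplex (y - y₀)‖ ≤ r / 4 →
      ‖∑ ξ ∈ near, a ξ * γ ξ * expTwoPiI ((inner ℝ (latticeVec (ξ - ξ₀)) y : ℝ) : ℂ)‖ ≤
        E.card * M * (1 / 2) ^ T := by
    intro y hy
    have h1 : ∑ ξ ∈ near, a ξ * γ ξ * expTwoPiI ((inner ℝ (latticeVec (ξ - ξ₀)) y : ℝ) : ℂ) =
        ∑ ξ ∈ near, a ξ * J ξ y :=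
      Finset.sum_congr rfl fun ξ hξ => by rw [hJnear ξ hξ y, mul_assoc]
    have h2 := hJsum y hy
    rw [hsplit] at h2
    rw [h1, eq_neg_of_add_eq_zero_left h2, norm_neg]
    calc ‖∑ ξ ∈ far, a ξ * J ξ y‖ ≤ ∑ _ξ ∈ far, M * (1 / 2) ^ T := by
          refine norm_sum_le_of_le _ fun ξ hξ => ?_
          rw [norm_mul]
          exact mul_le_mul (haM ξ (Finset.mem_filter.1 hξ).1) (hJfar ξ hξ y hy) (norm_nonneg _) hM0
      _ = far.card * (M * (1 / 2) ^ T) := by simp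
      _ ≤ E.card * (M * (1 / 2) ^ T) := by gcongr
      _ = _ := by ring
  -- the frequencies of the cluster, recentred at `ξ₀`
  by_cases hξ₀near : ξ₀ ∈ near
  swap
  -- Degenerate case: `ξ₀` misses its own cluster only if `D < 0`. The other alternative then forces
  -- `R ≤ 0`, so `T = 0` and the trivial bound suffices.
  · have h1 : ξ₀ ∈ far := by
      rw [hfar, Finset.mem_filter]
      refine ⟨hξ₀, fun h => hξ₀near ?_⟩
      rw [hnear, Finset.mem_filter]
      exact ⟨hξ₀, h⟩
    obtain ⟨_, j, hj⟩ := (hcl ξ₀ hξ₀).resolve_left (Finset.mem_filter.1 h1).2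
    have hR : R ≤ 0 := by simpa using hj
    have hT0 : T = 0 := by
      have : (T : ℝ) ≤ 0 := hT.trans (mul_nonpos_of_nonpos_of_nonneg hR (by positivity))
      exact_mod_cast le_antisymm this (Nat.cast_nonneg T)
    subst hT0
    have hE1 : (1 : ℝ) ≤ E.card := by
      exact_mod_cast Finset.card_pos.2 ⟨ξ₀, hξ₀⟩
    have h2 : (α / ((0 : ℕ) + 1)) ^ d ≤ (1 : ℝ) := by
      refine pow_le_one₀ (by positivity) ?_
      simp
      linarith
    have h3 : (2 * h) ^ n ≤ 1 := pow_le_one₀ (by positivity) hh1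
    calc ‖a ξ₀‖ * (α / ((0 : ℕ) + 1)) ^ d * (2 * h) ^ n ≤ M * 1 * 1 := by
          gcongr
          exact haM ξ₀ hξ₀
      _ ≤ E.card * M * (1 / 2) ^ 0 := by nlinarith
  let N : Finset (Fin d → ℤ) := (near.erase ξ₀).image fun ξ => ξ - ξ₀
  have hinj : Function.Injective fun ξ : Fin d → ℤ => ξ - ξ₀ := sub_left_injective
  have hNcard : N.card ≤ n := by
    rw [Finset.card_image_of_injective _ hinj]
    refine hn _ ((Finset.erase_subset _ _).trans (Finset.filter_subset _ _)) fun ξ hξ => ?_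
    exact (Finset.mem_filter.1 (Finset.mem_of_mem_erase hξ)).2.2
  have hD0 : ∀ ξ ∈ N, ∀ i, |(ξ i : ℝ)| ≤ D := by
    intro ξ hξ
    obtain ⟨η, hη, rfl⟩ := Finset.mem_image.1 hξ
    exact (Finset.mem_filter.1 (Finset.mem_of_mem_erase hη)).2.2
  have hzero : (0 : Fin d → ℤ) ∉ N := by
    intro hmem
    obtain ⟨η, hη, h1⟩ := Finset.mem_image.1 hmem
    exact (Finset.ne_of_mem_erase hη) (sub_eq_zero.1 h1)
  have hcardD : N.card * (h * D) ≤ r / 4 := by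
    rcases N.eq_empty_or_nonempty with hN | ⟨ξ, hξ⟩
    · rw [hN]; simp; linarith
    · have hd : 0 ≤ D := by
        obtain ⟨i, _⟩ := Function.ne_iff.1 (fun h => hzero (h ▸ hξ) : ξ ≠ 0)
        exact (abs_nonneg _).trans (hD0 ξ hξ i)
      refine le_trans ?_ hhr
      gcongr
  have hmain := norm_coeff_le_of_exp_sum_le hh hhD N hzero hD0
    (fun η => a (η + ξ₀) * γ (η + ξ₀)) (a ξ₀ * γ ξ₀) (E.card * M * (1 / 2) ^ T) (r / 4) hcardD
    (y₀ := y₀) (by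
      intro y hy
      refine le_trans (le_of_eq ?_) (hbound y hy)
      congr 1
      rw [← Finset.add_sum_erase _ _ hξ₀near]
      congr 1
      · have : latticeVec (ξ₀ - ξ₀) = 0 := by rw [latticeVec_sub, sub_self]
        rw [this, inner_zero_left, Complex.ofReal_zero, expTwoPiI_zero, mul_one]
      · rw [Finset.sum_image fun _ _ _ _ h => hinj h]
        simp)
  -- At `ξ₀` the multiplier is the mass of the bump.
  have hγ : (α / (T + 1)) ^ d ≤ ‖γ ξ₀‖ := by
    have h1 : γ ξ₀ = ((∫ t in cube d α, bump α T t : ℝ) : ℂ) := by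
      have h2 : complexInner (latticeVec (ξ₀ - ξ₀)) = 0 := by
        ext z
        rw [latticeVec_sub, sub_self, complexInner_apply]
        simp
      simp only [γ, h2]
      rw [← integral_complex_ofReal]
      simp [expTwoPiI_zero]
    rw [h1, Complex.norm_real]
    exact (le_integral_bump hα T d).trans (le_abs_self _)
  calc ‖a ξ₀‖ * (α / (T + 1)) ^ d * (2 * h) ^ n ≤ ‖a ξ₀‖ * ‖γ ξ₀‖ * (2 * h) ^ N.card := by
        refine mul_le_mul (by gcongr) (pow_le_pow_of_le_one (by positivity) hh1 hNcard)
          (by positivity) (by positivity)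
    _ ≤ _ := by rw [← norm_mul]; exact hmain

end Extraction

/-! ### Balancing the estimates: exponential decay in a cap -/

section Decay

open Filter Topology

/-- The size estimates balancing the cluster: the loss from the finite differences is of order
`exp(D ^ (d + 1))`, the gain from the contour shift of order `exp(-D ^ (d + 4))`. -/
theorem eventually_cluster_loss_le (d : ℕ) {α : ℝ} (hα : 0 < α) (hα3 : α ≤ 1 / 3) :
    ∀ᶠ D : ℕ in atTop, ((⌊(D : ℝ) ^ (d + 4) * (α / 5)⌋₊ + 1 : ℝ) / α) ^ d *
      ((D : ℝ) ^ (d + 3)) ^ ((2 * D + 1) ^ d) * (1 / 2) ^ ⌊(D : ℝ) ^ (d + 4) * (α / 5)⌋₊ ≤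
        Real.exp (-D) := by
  -- By `x ≤ exp x`, the two loss factors are at most `exp(k x ^ (d + 1))`: the term `(d + 5) * d`
  -- comes from the bump mass, the term `(d + 3) * 3 ^ d` from the finite differences.
  set k : ℝ := (d + 5) * d + (d + 3) * 3 ^ d with hk
  have hk0 : 0 ≤ k := by positivity
  have hlim := tendsto_natCast_atTop_atTop (R := ℝ)
  filter_upwards [hlim.eventually_ge_atTop 2, hlim.eventually_ge_atTop (1 / α),
    hlim.eventually_ge_atTop (10 / α), hlim.eventually_ge_atTop (k + 2)] with D h2 h1α h10 hkD
  set x : ℝ := (D : ℝ) with hx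
  set T := ⌊x ^ (d + 4) * (α / 5)⌋₊ with hT
  have hx0 : 0 < x := by linarith
  have hx1 : 1 ≤ x := by linarith
  have hT1 : (T : ℝ) ≤ x ^ (d + 4) * (α / 5) := Nat.floor_le (by positivity)
  have hT2 : x ^ (d + 4) * (α / 5) < T + 1 := Nat.lt_floor_add_one _
  have hp4 : 2 ≤ x ^ (d + 4) := h2.trans (le_self_pow₀ hx1 (by omega))
  have hTx : (T : ℝ) + 1 ≤ x ^ (d + 4) := by nlinarith
  have hlog : x ≤ Real.exp x := by linarith [Real.add_one_le_exp x]
  have hA : ((T + 1 : ℝ) / α) ^ d ≤ Real.exp (x * ((d + 5) * d)) := by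
    calc ((T + 1 : ℝ) / α) ^ d = ((T + 1) * (1 / α)) ^ d := by ring
      _ ≤ (x ^ (d + 4) * x) ^ d := by gcongr
      _ = x ^ ((d + 5) * d) := by rw [← pow_succ, ← pow_mul]
      _ ≤ Real.exp x ^ ((d + 5) * d) := by gcongr
      _ = _ := by rw [← Real.exp_nat_mul]; push_cast; ring_nf
  have hB : (x ^ (d + 3)) ^ ((2 * D + 1) ^ d) ≤ Real.exp (x * ((d + 3) * (3 ^ d * x ^ d))) := by
    calc (x ^ (d + 3)) ^ ((2 * D + 1) ^ d) = x ^ ((d + 3) * (2 * D + 1) ^ d) := by rw [← pow_mul]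
      _ ≤ Real.exp x ^ ((d + 3) * (2 * D + 1) ^ d) := by gcongr
      _ = Real.exp (x * ((d + 3) * (2 * x + 1) ^ d)) := by
        rw [← Real.exp_nat_mul, hx]; push_cast; ring_nf
      _ ≤ _ := by
        rw [← mul_pow]
        gcongr
        linarith
  have hC : (1 / 2 : ℝ) ^ T ≤ Real.exp (-(x ^ (d + 4) * (α / 5) - 1) / 2) := by
    have h3 : (1 / 2 : ℝ) ≤ Real.exp (-(1 / 2)) := by
      linarith [Real.add_one_le_exp (-(1 / 2) : ℝ)]
    calc (1 / 2 : ℝ) ^ T ≤ Real.exp (-(1 / 2)) ^ T := by gcongr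
      _ = Real.exp (T * (-(1 / 2))) := by rw [← Real.exp_nat_mul]
      _ ≤ _ := Real.exp_le_exp.2 (by linarith)
  calc _ ≤ Real.exp (x * ((d + 5) * d)) * Real.exp (x * ((d + 3) * (3 ^ d * x ^ d))) *
        Real.exp (-(x ^ (d + 4) * (α / 5) - 1) / 2) := by gcongr
    _ = Real.exp (x * ((d + 5) * d) + x * ((d + 3) * (3 ^ d * x ^ d)) +
        -(x ^ (d + 4) * (α / 5) - 1) / 2) := by rw [Real.exp_add, Real.exp_add]
    _ ≤ _ := by
      refine Real.exp_le_exp.2 ?_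
      have hq : 1 ≤ x ^ d := one_le_pow₀ hx1
      have h4 : 1 ≤ x * α / 10 := by
        rw [div_le_iff₀ hα] at h10
        linarith
      have h5 : x * ((d + 5) * d) ≤ x * ((d + 5) * d) * x ^ d :=
        le_mul_of_one_le_right (by positivity) hq
      have h6 : x * ((d + 5) * d) + x * ((d + 3) * (3 ^ d * x ^ d)) ≤ k * (x * x ^ d) := by
        rw [hk]; nlinarith
      have h7 : (k + 2) * (x * x ^ d) ≤ x ^ (d + 4) * (α / 5) / 2 := by
        have : (k + 2) * (x * x ^ d) ≤ x * x * (x * x ^ d) := by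
          gcongr
          nlinarith
        calc (k + 2) * (x * x ^ d) ≤ x * x * (x * x ^ d) := this
          _ ≤ x * x * (x * x ^ d) * (x * α / 10) := le_mul_of_one_le_right (by positivity) h4
          _ = _ := by ring
      have h8 : 1 ≤ x * x ^ d := by nlinarith
      have h9 : x ≤ x * x ^ d := le_mul_of_one_le_right hx0.le hq
      linarith

variable {d : ℕ}

theorem card_le_of_abs_sub_le {D : ℕ} {ξ₀ : Fin d → ℤ} (N : Finset (Fin d → ℤ))
    (hN : ∀ ξ ∈ N, ∀ i, |((ξ i - ξ₀ i : ℤ) : ℝ)| ≤ D) : N.card ≤ (2 * D + 1) ^ d := by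
  have h1 : N ⊆ Fintype.piFinset fun i => Finset.Icc (ξ₀ i - D) (ξ₀ i + D) := by
    intro ξ hξ
    rw [Fintype.mem_piFinset]
    intro i
    have h2 : |ξ i - ξ₀ i| ≤ (D : ℤ) := by exact_mod_cast hN ξ hξ i
    rw [abs_le] at h2
    rw [Finset.mem_Icc]
    omega
  refine (Finset.card_le_card h1).trans (le_of_eq ?_)
  rw [Fintype.card_piFinset]
  have : ∀ m : ℤ, (m + D + 1 - (m - D)).toNat = 2 * D + 1 := fun m => by omega
  simp [this]

/-- The squared norm is a positive integer. -/
theorem one_le_norm_latticeVec {ξ : Fin d → ℤ} (h : 0 < ‖latticeVec ξ‖) : 1 ≤ ‖latticeVec ξ‖ := by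
  have h1 : 0 < ‖latticeVec ξ‖ ^ 2 := by positivity
  have h2 : 1 ≤ ‖latticeVec ξ‖ ^ 2 := by
    rw [norm_latticeVec_sq] at h1 ⊢
    have h3 : (0 : ℤ) < ∑ i, ξ i ^ 2 := by exact_mod_cast h1
    exact_mod_cast h3
  nlinarith

/-- Off a flat hypersurface, the Fourier coefficients in a cap are smaller than
`exp(-λ ^ δ)`, up to a polynomial factor. -/
theorem exists_cap_norm_mFourierCoeff_le {S : Set (UnitAddTorus (Fin d))}
    (hflat : ¬ IsFlatHypersurface S) :
    ∃ (w : EuclideanSpace ℝ (Fin d)) (r δ : ℝ), ‖w‖ = 1 ∧ 0 < r ∧ 0 < δ ∧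
      ∀ᶠ lam : ℝ in atTop, ∀ φ : UnitAddTorus (Fin d) → ℂ, IsTorusEigenfunction lam φ →
        (∀ p ∈ S, φ p = 0) → ∀ ξ₀ : Fin d → ℤ, ‖latticeVec ξ₀‖ = lam →
        dist (lam⁻¹ • latticeVec ξ₀) w < r → ‖UnitAddTorus.mFourierCoeff φ ξ₀‖ ≤
          (2 * lam + 1) ^ d * torusL2Norm φ * Real.exp (-lam ^ δ) := by
  obtain ⟨y₀, w, r, hw, hr, hgeom⟩ := exists_complex_points_along_lines hflat
  -- The cluster has at most `(2 D + 1) ^ d` points, whose removal costs `exp` of order at most `D ^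
  -- (d + 1)`; isolation `D ^ (d + 4)` more than compensates.
  obtain ⟨δ, hδ, lam₀, hlam₀, hcluster⟩ := exists_isolated_cluster d (d + 4)
  -- Half of the radius is kept for the distance, at most `lam ^ (-1 / 2)`, between the pole `ω` and
  -- the direction of `ξ₀`.
  refine ⟨w, r / 2, δ, hw, by positivity, hδ, ?_⟩
  set α := min (1 / 3) (r / 4) with hα
  have hα0 : 0 < α := lt_min (by norm_num) (by positivity)
  have hα3 : α ≤ 1 / 3 := min_le_left _ _
  have hαr : 4 * α ≤ r := by linarith [min_le_right (1 / 3) (r / 4)]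
  have hlim := tendsto_natCast_atTop_atTop (R := ℝ)
  obtain ⟨D₀, hD₀⟩ := eventually_atTop.1 ((eventually_cluster_loss_le d hα0 hα3).and
    ((hlim.eventually_ge_atTop 2).and ((hlim.eventually_ge_atTop (2 * d)).and
      (hlim.eventually_ge_atTop (4 * 3 ^ d / r)))))
  have hsmall : ∀ᶠ lam : ℝ in atTop, lam ^ (-(1 / 2) : ℝ) < r / 2 :=
    (tendsto_rpow_neg_atTop (by norm_num)).eventually_lt_const (by positivity)
  filter_upwards [eventually_ge_atTop lam₀, hsmall,
    (tendsto_rpow_atTop hδ).eventually_ge_atTop (D₀ : ℝ)] with lam hlam hlamr hlamD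
  intro φ hφ hvan ξ₀ hξ₀ hcap
  have hlam1 : 1 ≤ lam := hlam₀.trans hlam
  have hξ₀E := mem_sphereLattice.2 hξ₀
  obtain ⟨D, ω, hD, -, hωdist, hcl⟩ := hcluster lam hlam ξ₀ hξ₀E
  obtain ⟨hloss, hD2, hDd, hDr⟩ := hD₀ D (by exact_mod_cast hlamD.trans hD)
  obtain ⟨W, hWd, hWim, hW⟩ := hgeom ω (by
    calc dist ω w ≤ dist ω (lam⁻¹ • latticeVec ξ₀) + dist (lam⁻¹ • latticeVec ξ₀) w :=
          dist_triangle _ _ _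
      _ < r := by linarith)
  have hD0 : (0 : ℝ) < D := by linarith
  have hD1 : (1 : ℝ) ≤ D := by linarith
  -- Small enough that `(2 D + 1) ^ d` steps of length at most `h D` stay within `r / 4`, and that
  -- `h d D ^ 2 ≤ 1 / 2`.
  set h : ℝ := 1 / (D : ℝ) ^ (d + 3) with hh
  have hh0 : 0 < h := by positivity
  have hsum : ∀ y ∈ Metric.ball (toComplex y₀) r,
      ∑ ξ ∈ sphereLattice d lam, UnitAddTorus.mFourierCoeff φ ξ *
        expTwoPiI (complexInner (latticeVec ξ) (y + W y • toComplex ω)) = 0 := by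
    -- The finite Fourier sum of `φ` is its entire extension, zero at the lifts of `S`.
    refine hW (fun z => ∑ ξ ∈ sphereLattice d lam, UnitAddTorus.mFourierCoeff φ ξ *
      expTwoPiI (complexInner (latticeVec ξ) z)) ?_ ?_
    · refine Differentiable.fun_sum fun ξ _ => ?_
      exact (differentiable_expTwoPiI.comp (complexInner _).differentiable).const_mul _
    · intro x hx
      exact (hφ.eq_sum (by linarith) x).symm.trans (hvan _ hx)
  set T := ⌊(D : ℝ) ^ (d + 4) * (α / 5)⌋₊ with hT
  have hsq : h * D ^ (d + 3) = 1 := by rw [hh]; field_simp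
  have hhD : h * (d * (D : ℝ) ^ 2) ≤ 1 / 2 := by
    have h1 : (D : ℝ) ^ 3 ≤ D ^ (d + 3) := pow_le_pow_right₀ hD1 (by omega)
    have h2 : 2 * (d * (D : ℝ) ^ 2) ≤ D ^ (d + 3) := by nlinarith [sq_nonneg (D : ℝ)]
    nlinarith
  have hh1 : 2 * h ≤ 1 := by
    have h1 : (D : ℝ) ≤ D ^ (d + 3) := le_self_pow₀ hD1 (by omega)
    nlinarith
  have hhr : ((2 * D + 1) ^ d : ℕ) * (h * D) ≤ r / 4 := by
    have h1 : (((2 * D + 1) ^ d : ℕ) : ℝ) ≤ 3 ^ d * D ^ d := by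
      push_cast
      rw [← mul_pow]
      gcongr
      linarith
    have h2 : (3 : ℝ) ^ d ≤ r / 4 * D := by
      rw [div_le_iff₀ hr] at hDr
      linarith
    calc (((2 * D + 1) ^ d : ℕ) : ℝ) * (h * D) ≤ 3 ^ d * D ^ d * (h * D) := by gcongr
      _ ≤ r / 4 * D * D ^ d * (h * D) := by gcongr
      _ ≤ r / 4 * D * D ^ d * (h * D) * D := le_mul_of_one_le_right (by positivity) hD1
      _ = r / 4 * (h * D ^ (d + 3)) := by ring
      _ = r / 4 := by rw [hsq, mul_one]
  have hmain := norm_coeff_le_of_cluster (T := T) hWd hWim hsum hξ₀E hcl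
    (fun ξ _ => norm_mFourierCoeff_le hφ.continuous ξ) hα0 hα3 hαr (Nat.floor_le (by positivity))
    hh0 hhD (fun N _ hN => card_le_of_abs_sub_le N hN) hh1 hhr
  set a := ‖UnitAddTorus.mFourierCoeff φ ξ₀‖ with ha
  set n := (2 * D + 1) ^ d with hn
  have hM : 0 ≤ torusL2Norm φ := Real.sqrt_nonneg _
  have hcard := card_sphereLattice_le (d := d) (lam := lam) (by linarith)
  have hinv1 : ((T + 1 : ℝ) / α) ^ d * (α / (T + 1)) ^ d = 1 := by
    rw [← mul_pow]
    have hT0 : (T + 1 : ℝ) ≠ 0 := by positivity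
    field_simp
    simp
  have hinv2 : ((D : ℝ) ^ (d + 3)) ^ n * h ^ n = 1 := by
    rw [← mul_pow, mul_comm, hsq, one_pow]
  have h2n : h ^ n ≤ (2 * h) ^ n := by gcongr; linarith
  calc a = a * (((T + 1 : ℝ) / α) ^ d * (α / (T + 1)) ^ d) *
        (((D : ℝ) ^ (d + 3)) ^ n * h ^ n) := by rw [hinv1, hinv2, mul_one, mul_one]
    _ = ((T + 1 : ℝ) / α) ^ d * ((D : ℝ) ^ (d + 3)) ^ n *
        (a * (α / (T + 1)) ^ d * h ^ n) := by ring
    _ ≤ ((T + 1 : ℝ) / α) ^ d * ((D : ℝ) ^ (d + 3)) ^ n *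
        (a * (α / (T + 1)) ^ d * (2 * h) ^ n) := by gcongr
    _ ≤ ((T + 1 : ℝ) / α) ^ d * ((D : ℝ) ^ (d + 3)) ^ n *
        ((sphereLattice d lam).card * torusL2Norm φ * (1 / 2) ^ T) := by gcongr
    _ = (sphereLattice d lam).card * torusL2Norm φ *
        (((T + 1 : ℝ) / α) ^ d * ((D : ℝ) ^ (d + 3)) ^ n * (1 / 2) ^ T) := by ring
    _ ≤ (2 * lam + 1) ^ d * torusL2Norm φ * Real.exp (-D) := by gcongr
    _ ≤ _ := by gcongr

end Decay

/-! ### From exponential decay to every power of `λ` -/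

theorem theorem1p3 (d : ℕ) (S : Set (UnitAddTorus (Fin d)))
    (hS : IsAnalyticHypersurface S) (hflat : ¬ IsFlatHypersurface S) :
    ∃ (w : EuclideanSpace ℝ (Fin d)) (r : ℝ), ‖w‖ = 1 ∧ 0 < r ∧
      ∀ N : ℝ, ∃ C : ℝ, 0 < C ∧
        ∀ (lam : ℝ), 0 < lam →
        ∀ φ : UnitAddTorus (Fin d) → ℂ, IsTorusEigenfunction lam φ → (∀ p ∈ S, φ p = 0) →
        ∀ ξ : Fin d → ℤ, ‖latticeVec ξ‖ = lam →
          ‖latticeVec ξ‖⁻¹ • latticeVec ξ ∈ sphericalCap w r →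
          ‖UnitAddTorus.mFourierCoeff φ ξ‖ ≤ C * (torusL2Norm φ / lam ^ N) := by
  obtain ⟨w, r, δ, hw, hr, hδ, hev⟩ := exists_cap_norm_mFourierCoeff_le hflat
  refine ⟨w, r, hw, hr, fun N => ?_⟩
  -- `exp(-λ ^ δ)` beats `λ ^ (N + d)`, where the extra `d` pays for the factor `(2 λ + 1) ^ d`.
  have hdecay : ∀ᶠ lam : ℝ in Filter.atTop,
      (lam ^ δ) ^ ((N + d) / δ) * Real.exp (-1 * lam ^ δ) < 1 :=
    ((tendsto_rpow_mul_exp_neg_mul_atTop_nhds_zero ((N + d) / δ) 1 one_pos).comp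
      (tendsto_rpow_atTop hδ)).eventually_lt_const one_pos
  obtain ⟨L, hL⟩ := Filter.eventually_atTop.1 (hev.and hdecay)
  -- The first term serves large `lam`. The second serves `1 ≤ lam ≤ L`, where the trivial bound by
  -- the `L²` norm is used; the absolute value covers negative `N`.
  refine ⟨3 ^ d + max 1 L ^ |N|, by positivity, ?_⟩
  intro lam hlam φ hφ hvan ξ hξ hcap
  have hlam1 : 1 ≤ lam := hξ ▸ one_le_norm_latticeVec (hξ ▸ hlam)
  have hM : 0 ≤ torusL2Norm φ := Real.sqrt_nonneg _
  have hpow : 0 < lam ^ N := Real.rpow_pos_of_pos hlam N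
  rw [← mul_div_assoc, le_div_iff₀ hpow]
  rcases le_total L lam with hLlam | hLlam
  · obtain ⟨h1, h2⟩ := hL lam hLlam
    rw [hξ] at hcap
    have h3 := h1 φ hφ hvan ξ hξ hcap.2
    rw [← Real.rpow_mul hlam.le, mul_div_cancel₀ _ hδ.ne', Real.rpow_add hlam,
      Real.rpow_natCast, neg_one_mul] at h2
    calc ‖UnitAddTorus.mFourierCoeff φ ξ‖ * lam ^ N
        ≤ (2 * lam + 1) ^ d * torusL2Norm φ * Real.exp (-lam ^ δ) * lam ^ N := by gcongr
      _ ≤ (3 * lam) ^ d * torusL2Norm φ * Real.exp (-lam ^ δ) * lam ^ N := by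
        gcongr
        linarith
      _ = 3 ^ d * torusL2Norm φ * (lam ^ N * lam ^ d * Real.exp (-lam ^ δ)) := by ring
      _ ≤ 3 ^ d * torusL2Norm φ * 1 := by gcongr
      _ ≤ _ := by
        rw [mul_one]
        gcongr
        exact le_add_of_nonneg_right (by positivity)
  · have h1 : lam ^ N ≤ max 1 L ^ |N| :=
      (Real.rpow_le_rpow_of_exponent_le hlam1 (le_abs_self N)).trans
        (Real.rpow_le_rpow hlam.le (hLlam.trans (le_max_right _ _)) (abs_nonneg N))
    calc ‖UnitAddTorus.mFourierCoeff φ ξ‖ * lam ^ N ≤ torusL2Norm φ * max 1 L ^ |N| :=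
          mul_le_mul (norm_mFourierCoeff_le hφ.continuous ξ) h1 hpow.le hM
      _ = max 1 L ^ |N| * torusL2Norm φ := mul_comm _ _
      _ ≤ _ := by
        gcongr
        exact le_add_of_nonneg_left (by positivity)
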